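/- Let $X\subset\mathbb R^d$ ($d\ge 1$) be compact with positive Lebesgue measure, and let $\mathrm{Leb}$ be the Lebesgue measure restricted to $X$ and normalized to mass $1$. Let $\mathbb M=L^2(X,\mathbb R^d)$ with its norm $\|\cdot\|$ taken with respect to $\mathrm{Leb}$, and let $\mathbb S\subset\mathbb M$ be the set of maps $s$ with $s\#\mathrm{Leb}=\mathrm{Leb}$. For each integer $N\ge1$ let $\mathcal P_N$ be a partition of $X$ into $N$ measurable regions $P_1,\dots,P_N$ with $\mathrm{Leb}(P_j)=1/N$ and $\operatorname{diam}P_j\le C_{\mathcal P}N^{-1/d}$, and let $\mathbb M_N\subset\mathbb M$ be the subspace of maps that are constant (almost everywhere) on each region. Fix $s_*,s^*\in\mathbb S$. For integers $T,N\ge1$ and real $\lambda>0$ let $$\mathcal E(T,N,\lambda)=\min_{m\in\mathbb M_N^{T+1}}\ T\sum_{0\le i<T}\|m_{i+1}-m_i\|^2+\lambda\Big(\|m_0-s_*\|^2+\|m_T-s^*\|^2+\sum_{1\le i<T}\inf_{s\in\mathbb S}\|m_i-s\|^2\Big),\qquad(1)$$ and $\mathcal E'(T,N,\lambda)=(1+4T/\lambda)\,\mathcal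 E(T,N,\lambda)$. Let $\Omega=C^0([0,1],X)$, regarded as a subset of $C^0([0,1],\mathbb R^d)$, let $e_t(\omega)=\omega(t)$, and let $\mathcal A(\omega)=\int_0^1|\dot\omega(t)|^2\,dt$ if $\omega\in H^1$, and $\mathcal A(\omega)=+\infty$ otherwise. The relaxed problem is $$d^2(s_*,s^*)=\inf\Big\{\int_\Omega\mathcal A\,d\mu:\ \mu\in\mathrm{Prob}(\Omega),\ (e_0,e_1)\#\mu=(s_*,s^*)\#\mathrm{Leb},\ e_t\#\mu=\mathrm{Leb}\ \ \forall t\in[0,1]\Big\}.\qquad(2)$$ To a chain $m=(m_i)_{i=0}^T\in\mathbb M_N^{T+1}$ associate the generalized flow $\mu=\frac1N\sum_{j=1}^N\delta_{\omega_j}\in\mathrm{Prob}(C^0([0,1],\mathbb R^d))$, where $\omega_j$ is the piecewise linear path which takes at each time $i/T$, $0\le i\le T$, the constant value of $m_i$ on $P_j$, and is affine between two successive such times. $W_2$ denotes the Wasserstein distance for the quadratic cost. Let $T,N\ge1$, $\lambda>0$, and let $m$ be a minimizer of (1). (a) (Classical construction) Let $s_0=s_*$, $s_T=s^*$, and for $1\le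 i<T$ let $s_i$ be a projection of $m_i$ onto $\mathbb S$ (an element of $\mathbb S$ at minimal distance from $m_i$). Then $$T\sum_{0\le i<T}\|s_{i+1}-s_i\|^2\le\mathcal E'(T,N,\lambda).$$ (b) (Relaxed construction) The generalized flow $\mu$ associated with $m$ satisfies $$\int_0^1W_2^2(e_t\#\mu,\mathrm{Leb})\,dt\le\frac1{4T^2}\,\mathcal E'(T,N,\lambda).$$ (c) (Convergence) Assume $d^2(s_*,s^*)<\infty$, and let $N_T\ge1$ and $\lambda_T>0$ be such that $\mathcal E'(T,N_T,\lambda_T)\to d^2(s_*,s^*)$ as $T\to\infty$. For each $T$ let $\mu_T$ be the generalized flow associated with a minimizer of (1) for the parameters $(T,N_T,\lambda_T)$. Then a subsequence of $(\mu_T)$ converges weak-* (against bounded continuous functions on $C^0([0,1],\mathbb R^d)$) to a minimizer $\mu\in\mathrm{Prob}(\Omega)$ of (2). -/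

import Mathlib

open MeasureTheory Filter Topology Set
open scoped ENNReal unitInterval

noncomputable section

namespace GenFlow

/-- The Euclidean space `ℝᵈ`. -/
abbrev Euc (d : ℕ) : Type := EuclideanSpace ℝ (Fin d)

/-- Spaces of continuous paths (uniform topology) carry their Borel sigma-algebra. -/
instance pathMeasurableSpace {Y : Type*} [TopologicalSpace Y] : MeasurableSpace C(I, Y) :=
  borel _

instance pathBorelSpace {Y : Type*} [TopologicalSpace Y] : BorelSpace C(I, Y) := ⟨rfl⟩

variable {d : ℕ}

/-- Lebesgue measure restricted to `X`, normalized to have mass one. -/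
def leb (X : Set (Euc d)) : Measure (Euc d) := (volume X)⁻¹ • volume.restrict X

/-- The Hilbert space `𝕄 = L²(X, ℝᵈ)`, for the normalized Lebesgue measure on `X`. -/
abbrev MM (X : Set (Euc d)) : Type := Lp (Euc d) 2 (leb X)

/-- The set `𝕊 ⊆ 𝕄` of maps which preserve the normalized Lebesgue measure on `X`. -/
def SS (X : Set (Euc d)) : Set (MM X) := {s | (leb X).map s = leb X}

/-- `s` is a projection of `m` onto `𝕊`: a point of `𝕊` at minimal `L²` distance from `m`. -/
def IsProjSS (X : Set (Euc d)) (m s : MM X) : Prop :=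
  s ∈ SS X ∧ ∀ s' ∈ SS X, ‖m - s‖ ≤ ‖m - s'‖

/-- `P` is a partition of `X` into `N` measurable regions of equal (normalized) area `1 / N`
and of diameter at most `C * N ^ (-1 / d)`. -/
structure IsEquipartition (X : Set (Euc d)) (C : ℝ) {N : ℕ} (P : Fin N → Set (Euc d)) :
    Prop where
  measurableSet : ∀ j, MeasurableSet (P j)
  pairwise_disjoint : Pairwise fun i j => Disjoint (P i) (P j)
  iUnion_eq : ⋃ j, P j = X
  area : ∀ j, leb X (P j) = (N : ℝ≥0∞)⁻¹
  diam_le : ∀ j, Metric.diam (P j) ≤ C * (N : ℝ) ^ (-(1 / (d : ℝ)))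

/-- The subspace `𝕄_N ⊆ 𝕄` of the maps which are constant on each region of the partition. -/
def MN (X : Set (Euc d)) {N : ℕ} (P : Fin N → Set (Euc d)) : Submodule ℝ (MM X) where
  carrier := {f | ∀ j, ∃ c : Euc d, ∀ᵐ x ∂(leb X), x ∈ P j → f x = c}
  zero_mem' := fun j => ⟨0, by
    filter_upwards [Lp.coeFn_zero (Euc d) 2 (leb X)] with x hx _
    exact hx⟩
  add_mem' := by
    intro f g hf hg j
    obtain ⟨a, ha⟩ := hf j
    obtain ⟨b, hb⟩ := hg j
    refine ⟨a + b, ?_⟩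
    filter_upwards [Lp.coeFn_add f g, ha, hb] with x hx h1 h2 hj
    rw [hx, Pi.add_apply, h1 hj, h2 hj]
  smul_mem' := by
    intro r f hf j
    obtain ⟨a, ha⟩ := hf j
    refine ⟨r • a, ?_⟩
    filter_upwards [Lp.coeFn_smul r f, ha] with x hx h1 hj
    rw [hx, Pi.smul_apply, h1 hj]

/-- The constant value of `f ∈ 𝕄_N` on the `j`-th region (unique, as the region has positive
measure). -/
def cellValue {X : Set (Euc d)} {N : ℕ} {P : Fin N → Set (Euc d)} (f : MN X P) (j : Fin N) :
    Euc d := (f.2 j).choose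

/-- The functional of the discrete problem, for a chain `m = (m₀, …, m_T)` in `𝕄`:
`T ∑_{0 ≤ i < T} ‖m_{i+1} - m_i‖²
  + lam (‖m₀ - s₀‖² + ‖m_T - s₁‖² + ∑_{1 ≤ i < T} inf_{s ∈ 𝕊} ‖m_i - s‖²)`. -/
def discreteFunctional (X : Set (Euc d)) (s₀ s₁ : MM X) {T : ℕ} (lam : ℝ)
    (m : Fin (T + 1) → MM X) : ℝ :=
  T * ∑ i : Fin T, ‖m i.succ - m i.castSucc‖ ^ 2
    + lam * (‖m 0 - s₀‖ ^ 2 + ‖m (Fin.last T) - s₁‖ ^ 2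
      + ∑ i ∈ Finset.Ioo 0 (Fin.last T), ⨅ s : SS X, ‖m i - s‖ ^ 2)

/-- The value `𝓔(T, N, lam)` of the discrete problem: the infimum over chains in `𝕄_N`. -/
def discreteEnergy (X : Set (Euc d)) (s₀ s₁ : MM X) (T : ℕ) {N : ℕ} (P : Fin N → Set (Euc d))
    (lam : ℝ) : ℝ :=
  ⨅ m : Fin (T + 1) → MN X P, discreteFunctional X s₀ s₁ lam fun i => (m i : MM X)

/-- The quantity `𝓔'(T, N, lam) = (1 + 4 T / lam) 𝓔(T, N, lam)`. -/
def discreteEnergy' (X : Set (Euc d)) (s₀ s₁ : MM X) (T : ℕ) {N : ℕ} (P : Fin N → Set (Euc d))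
    (lam : ℝ) : ℝ :=
  (1 + 4 * T / lam) * discreteEnergy X s₀ s₁ T P lam

/-- The chain `m` in `𝕄_N` is a minimizer of the discrete problem. -/
def IsDiscreteMinimizer (X : Set (Euc d)) (s₀ s₁ : MM X) {T N : ℕ} {P : Fin N → Set (Euc d)}
    (lam : ℝ) (m : Fin (T + 1) → MN X P) : Prop :=
  ∀ m' : Fin (T + 1) → MN X P,
    discreteFunctional X s₀ s₁ lam (fun i => (m i : MM X))
      ≤ discreteFunctional X s₀ s₁ lam fun i => (m' i : MM X)

/-- The piecewise linear path in `ℝᵈ` with value `v i` at time `i / T`, written in the basis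
of hat functions: `t ↦ ∑ i, max (0, 1 - |T t - i|) v i`. -/
def plPath {T : ℕ} (v : Fin (T + 1) → Euc d) : C(I, Euc d) where
  toFun t := ∑ i : Fin (T + 1), max 0 (1 - |(T : ℝ) * (t : ℝ) - ((i : ℕ) : ℝ)|) • v i
  continuous_toFun := by fun_prop

/-- On `[i / T, (i + 1) / T]` the path `plPath v` interpolates linearly between `v i` and
`v (i + 1)`. -/
theorem plPath_apply {T : ℕ} (v : Fin (T + 1) → Euc d) (i : Fin T) (a : ℝ) (ha₀ : 0 ≤ a)
    (ha₁ : a ≤ 1) (t : I) (ht : (T : ℝ) * t = (i : ℕ) + a) :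
    plPath v t = (1 - a) • v i.castSucc + a • v i.succ := by
  have hne : i.castSucc ≠ i.succ := by
    intro h
    have := congrArg Fin.val h
    simp at this
  change ∑ k : Fin (T + 1), max 0 (1 - |(T : ℝ) * (t : ℝ) - ((k : ℕ) : ℝ)|) • v k = _
  rw [← Finset.sum_subset (Finset.subset_univ {i.castSucc, i.succ}), Finset.sum_pair hne, ht]
  · congr 2
    · simp [abs_of_nonneg ha₀, ha₁]
    · have h : ((i : ℕ) : ℝ) + a - ((i.succ : Fin (T + 1)) : ℕ) = -(1 - a) := by
        simp
      rw [h, abs_neg, abs_of_nonneg (by linarith)]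
      simp [ha₀]
  · intro k _ hk
    have h1 : (k : ℕ) ≠ i := fun h => hk (by simp [Fin.ext_iff, h])
    have h2 : (k : ℕ) ≠ i + 1 := fun h => hk (by simp [Fin.ext_iff, h])
    have h3 : 1 ≤ |((i : ℕ) : ℝ) + a - ((k : ℕ) : ℝ)| := by
      rcases lt_or_gt_of_ne h1 with h | h
      · have : ((k : ℕ) : ℝ) + 1 ≤ (i : ℕ) := by exact_mod_cast h
        exact le_abs.2 (Or.inl (by linarith))
      · have : ((i : ℕ) : ℝ) + 2 ≤ (k : ℕ) := by
          have : (i : ℕ) + 2 ≤ k := by omega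
          exact_mod_cast this
        exact le_abs.2 (Or.inr (by linarith))
    rw [ht, max_eq_left (by linarith), zero_smul]

/-- The measure equidistributed on the piecewise linear paths `ω_j`, `1 ≤ j ≤ N`, where `ω_j`
has at time `i / T` the value of `m_i` on the `j`-th region. -/
def plFlowMeasure {X : Set (Euc d)} {T N : ℕ} {P : Fin N → Set (Euc d)}
    (m : Fin (T + 1) → MN X P) : Measure C(I, Euc d) :=
  (N : ℝ≥0∞)⁻¹ • ∑ j : Fin N, Measure.dirac (plPath fun i => cellValue (m i) j)

/-- The generalized flow associated with the chain `m`, as a probability measure. -/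
def plFlow {X : Set (Euc d)} {T N : ℕ} [NeZero N] {P : Fin N → Set (Euc d)}
    (m : Fin (T + 1) → MN X P) : ProbabilityMeasure C(I, Euc d) :=
  ⟨plFlowMeasure m, ⟨by
    simp [plFlowMeasure,
      ENNReal.inv_mul_cancel (Nat.cast_ne_zero.2 (NeZero.ne N)) (ENNReal.natCast_ne_top N)]⟩⟩

/-- The squared quadratic Wasserstein distance: the infimum of the transport cost over all
couplings. -/
def W2sq (ρ ν : Measure (Euc d)) : ℝ≥0∞ :=
  ⨅ (π : Measure (Euc d × Euc d)) (_ : π.map Prod.fst = ρ) (_ : π.map Prod.snd = ν),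
    ∫⁻ z, edist z.1 z.2 ^ 2 ∂π

/-- The path action `∫₀¹ |ω'(t)|² dt`, where `ω'` is the weak derivative: it equals `⊤` unless
`ω` is the primitive of a square integrable function `g`, which is then unique almost
everywhere. -/
def action (w : C(I, Euc d)) : ℝ≥0∞ :=
  ⨅ (g : ℝ → Euc d) (_ : MemLp g 2 (volume.restrict (Icc 0 1)))
    (_ : ∀ t : I, w t = w 0 + ∫ r in (0 : ℝ)..t, g r), ∫⁻ r in Icc (0 : ℝ) 1, ‖g r‖ₑ ^ 2

/-- A path in `X`, regarded as a path in `ℝᵈ`. -/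
def incl (X : Set (Euc d)) (w : C(I, X)) : C(I, Euc d) := ⟨fun t => (w t : Euc d), by fun_prop⟩

theorem continuous_incl (X : Set (Euc d)) : Continuous (incl X) :=
  ContinuousMap.continuous_postcomp ⟨Subtype.val, continuous_subtype_val⟩

/-- The constraints of the relaxed problem on a generalized flow `μ ∈ Prob(Ω)`, where
`Ω = C⁰([0,1], X)`: `(e₀, e₁)#μ = (s₀, s₁)#Leb`, and `e_t#μ = Leb` for all `t`. -/
structure IsAdmissibleFlow (X : Set (Euc d)) (s₀ s₁ : MM X) (μ : ProbabilityMeasure C(I, X)) :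
    Prop where
  boundary : (μ : Measure C(I, X)).map (fun w => ((w 0 : Euc d), (w 1 : Euc d)))
    = (leb X).map fun x => (s₀ x, s₁ x)
  incompressible : ∀ t : I, (μ : Measure C(I, X)).map (fun w => (w t : Euc d)) = leb X

/-- The relaxed energy of a generalized flow. -/
def flowEnergy (X : Set (Euc d)) (μ : ProbabilityMeasure C(I, X)) : ℝ≥0∞ :=
  ∫⁻ w, action (incl X w) ∂(μ : Measure C(I, X))

/-- The value `d²(s₀, s₁)` of the relaxed problem. -/
def relaxedDistSq (X : Set (Euc d)) (s₀ s₁ : MM X) : ℝ≥0∞ :=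
  ⨅ (μ : ProbabilityMeasure C(I, X)) (_ : IsAdmissibleFlow X s₀ s₁ μ), flowEnergy X μ

/-- `μ` is a minimizer of the relaxed problem. -/
def IsRelaxedMinimizer (X : Set (Euc d)) (s₀ s₁ : MM X) (μ : ProbabilityMeasure C(I, X)) :
    Prop :=
  IsAdmissibleFlow X s₀ s₁ μ ∧
    ∀ ν : ProbabilityMeasure C(I, X), IsAdmissibleFlow X s₀ s₁ ν →
      flowEnergy X μ ≤ flowEnergy X ν

end GenFlow

end

open GenFlow

/-!
Evaluating a chain `m` in `𝕄_N` at a random point `x` of `X` gives a random piecewise linear path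
`x ↦ plPath (m · x)`, whose law is the flow associated with `m` (`plFlowMeasure_eq_map`). All
three statements then become estimates in `L²(X)`.

The factor `1 + 4 T / lam` in `𝓔'` comes from the weighted inequality
`(a + b)² ≤ (1 + c) (a² + b² / c)` with `c = 4 T / lam`. For the classical construction it is applied
to `s_{i+1} - s_i`, seen as `m_{i+1} - m_i` plus two projection errors
(`chain_energy_le_of_perturbation`). For the relaxed construction it is applied to the distance to
`𝕊` from a point `(1 - a) m_i + a m_{i+1}`, averaging with weights `1 - a` and `a` the two bounds
obtained through `m_i` and `m_{i+1}` (`infDist_sq_segment_le`); this distance bounds the Wasserstein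
distance of the law to the Lebesgue measure.

For the convergence, the energy `T ∑ ‖m_{i+1} - m_i‖²` of a minimizer is at most `𝓔'`, and each
penalized term is at most `𝓔' / (4 T)`, without any condition on `lam`. The first bound controls the
`1/2`-Hölder seminorms of the paths, hence tightness, by Arzelà-Ascoli and Prokhorov. The second one
shows that at each time the interpolated map gets close to `𝕊` in `L²`, and that the endpoints
converge in `L²` to `s₀` and `s₁`; so the limit flow satisfies the constraints, and it is carried by
paths in `X` because `X` is closed. Finally the action is dominated by the supremum, along dyadic
grids, of the energies of the increments, which are continuous functions of the path
(`action_le_iSup_gridEnergy`): the derivatives of the dyadic interpolations form a martingale bounded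
in `L²`, and its limit is the derivative of the path. As these energies do not exceed the chain
energy on piecewise linear paths (`gridEnergy_plPath_le`), the energy of the limit is at most
`lim 𝓔' = d²(s₀, s₁)`.
-/

namespace GenFlow

/-! ### The action as a supremum of energies along dyadic grids -/

theorem lintegral_enorm_sq_Lp {α E : Type*} [MeasurableSpace α] {μ : Measure α}
    [NormedAddCommGroup E] (f : Lp E 2 μ) :
    ∫⁻ x, ‖f x‖ₑ ^ 2 ∂μ = ENNReal.ofReal (‖f‖ ^ 2) := by
  rw [ENNReal.ofReal_pow (norm_nonneg _), ofReal_norm, Lp.enorm_def]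
  have := eLpNorm_nnreal_pow_eq_lintegral (f := f) (μ := μ) (p := 2) two_ne_zero
  simpa using this.symm

section StepDerivative

variable {E : Type*} [NormedAddCommGroup E] [InnerProductSpace ℝ E]

/-- The energy of the increments of `f` along the uniform grid of step `1 / n` in `[0, 1]`. -/
noncomputable def gridEnergy (n : ℕ) (f : ℝ → E) : ℝ :=
  n * ∑ k ∈ Finset.range n, ‖f ((k + 1 : ℕ) / n) - f ((k : ℕ) / n)‖ ^ 2

/-- The derivative of the piecewise linear interpolation of `f` along the uniform grid of step
`1 / n`, as an element of `L²(0, 1)`. -/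
noncomputable def stepDeriv (n : ℕ) (f : ℝ → E) : Lp E 2 (volume.restrict (Icc (0 : ℝ) 1)) :=
  ∑ k ∈ Finset.range n, indicatorConstLp 2 (s := Ioc ((k : ℕ) / n : ℝ) ((k + 1 : ℕ) / n))
    measurableSet_Ioc (measure_ne_top _ _) ((n : ℝ) • (f ((k + 1 : ℕ) / n) - f ((k : ℕ) / n)))

theorem measureReal_grid_inter {n i j k : ℕ} (hj : j ≤ n) (hk : k < n) :
    (volume.restrict (Icc (0 : ℝ) 1)).real
      (Ioc ((k : ℕ) / n : ℝ) ((k + 1 : ℕ) / n) ∩ Ioc ((i : ℕ) / n : ℝ) ((j : ℕ) / n))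
      = if k ∈ Finset.Ico i j then (1 / n : ℝ) else 0 := by
  have hn : (0 : ℝ) < n := by exact_mod_cast (by omega : 0 < n)
  have hj' : ((j : ℕ) : ℝ) / n ≤ 1 := by
    rw [div_le_one hn]; exact_mod_cast hj
  rw [measureReal_restrict_apply (by measurability), Ioc_inter_Ioc, inter_eq_left.2]
  · rw [Real.volume_real_Ioc]
    split_ifs with h
    · rw [Finset.mem_Ico] at h
      have h1 : ((i : ℕ) : ℝ) / n ≤ (k : ℕ) / n := by
        gcongr; exact_mod_cast h.1
      have h2 : ((k + 1 : ℕ) : ℝ) / n ≤ (j : ℕ) / n := by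
        gcongr; exact_mod_cast h.2
      rw [max_eq_left h1, min_eq_left h2, ← sub_div, max_eq_left]
      · push_cast; ring
      · push_cast; ring_nf; positivity
    · rw [max_eq_right]
      rw [Finset.mem_Ico, not_and_or, not_le, not_lt] at h
      rw [sub_nonpos]
      rcases h with h | h
      · refine (min_le_left _ _).trans (le_trans ?_ (le_max_right _ _))
        gcongr; exact_mod_cast h
      · refine (min_le_right _ _).trans (le_trans ?_ (le_max_left _ _))
        gcongr
  · intro x hx
    refine ⟨le_trans ?_ hx.1.le, hx.2.trans ((min_le_right _ _).trans hj')⟩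
    exact le_trans (by positivity) (le_max_left _ _)

variable [CompleteSpace E]

theorem setIntegral_stepDeriv (n : ℕ) (f : ℝ → E) {i j : ℕ} (hij : i ≤ j) (hj : j ≤ n) :
    ∫ x in Ioc ((i : ℕ) / n : ℝ) ((j : ℕ) / n), stepDeriv n f x ∂(volume.restrict (Icc (0 : ℝ) 1))
      = f ((j : ℕ) / n) - f ((i : ℕ) / n) := by
  -- Test the integral against an arbitrary vector `c`, which turns it into an inner product in `L²`.
  refine ext_inner_left ℝ fun c => ?_
  rw [← L2.inner_indicatorConstLp_eq_inner_setIntegral ℝ measurableSet_Ioc (measure_ne_top _ _),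
    stepDeriv, inner_sum]
  have h : ∀ k ∈ Finset.range n,
      inner ℝ (indicatorConstLp 2 (s := Ioc ((i : ℕ) / n : ℝ) ((j : ℕ) / n)) measurableSet_Ioc
          (measure_ne_top (volume.restrict (Icc (0 : ℝ) 1)) _) c)
        (indicatorConstLp 2 (s := Ioc ((k : ℕ) / n : ℝ) ((k + 1 : ℕ) / n)) measurableSet_Ioc
          (measure_ne_top (volume.restrict (Icc (0 : ℝ) 1)) _)
          ((n : ℝ) • (f ((k + 1 : ℕ) / n) - f ((k : ℕ) / n))))
      = if k ∈ Finset.Ico i j then inner ℝ c (f ((k + 1 : ℕ) / n) - f ((k : ℕ) / n)) else 0 := by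
    intro k hk
    rw [Finset.mem_range] at hk
    have hn : (n : ℝ) ≠ 0 := by exact_mod_cast (by omega : n ≠ 0)
    rw [L2.inner_indicatorConstLp_indicatorConstLp (𝕜 := ℝ), inter_comm,
      measureReal_grid_inter hj hk, inner_smul_right]
    split_ifs
    · rw [smul_eq_mul, ← mul_assoc, one_div, inv_mul_cancel₀ hn, one_mul]
    · rw [zero_smul]
  rw [Finset.sum_congr rfl h, ← Finset.sum_filter, Finset.filter_mem_eq_inter,
    Finset.inter_eq_right.2, ← inner_sum]
  · rw [Finset.sum_Ico_sub (fun k : ℕ => f ((k : ℕ) / n)) hij]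
  · intro k hk
    rw [Finset.mem_Ico] at hk
    exact Finset.mem_range.2 (by omega)

/-- The inner product with the step derivative on a coarser grid only sees the increments of `f`
along that grid. -/
theorem inner_stepDeriv_of_dvd {n m : ℕ} (f : ℝ → E) (hm : 0 < m) (h : n ∣ m) :
    inner ℝ (stepDeriv n f) (stepDeriv m f) = gridEnergy n f := by
  obtain ⟨q, rfl⟩ := h
  have hn : 0 < n := Nat.pos_of_mul_pos_right hm
  have hq : 0 < q := Nat.pos_of_mul_pos_left hm
  have hq' : (q : ℝ) ≠ 0 := by exact_mod_cast hq.ne'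
  have e : ∀ k : ℕ, ((k : ℕ) : ℝ) / n = ((k * q : ℕ) : ℝ) / (n * q : ℕ) := by
    intro k
    push_cast
    rw [mul_div_mul_right _ _ hq']
  rw [stepDeriv, sum_inner, gridEnergy, Finset.mul_sum]
  refine Finset.sum_congr rfl fun k hk => ?_
  rw [Finset.mem_range] at hk
  rw [L2.inner_indicatorConstLp_eq_inner_setIntegral ℝ, inner_smul_left]
  have hI := setIntegral_stepDeriv (n * q) f (i := k * q) (j := (k + 1) * q)
    (Nat.mul_le_mul_right _ (by omega)) (Nat.mul_le_mul_right _ (by omega))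
  rw [← e, ← e] at hI
  rw [hI, real_inner_self_eq_norm_sq]
  rfl

theorem norm_sq_stepDeriv {n : ℕ} (f : ℝ → E) (hn : 0 < n) :
    ‖stepDeriv n f‖ ^ 2 = gridEnergy n f := by
  rw [← real_inner_self_eq_norm_sq, inner_stepDeriv_of_dvd f hn dvd_rfl]

theorem norm_sq_stepDeriv_sub {n m : ℕ} (f : ℝ → E) (hn : 0 < n) (hm : 0 < m) (h : n ∣ m) :
    ‖stepDeriv m f - stepDeriv n f‖ ^ 2 = gridEnergy m f - gridEnergy n f := by
  rw [norm_sub_sq_real, real_inner_comm, inner_stepDeriv_of_dvd f hm h, norm_sq_stepDeriv f hm,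
    norm_sq_stepDeriv f hn]
  ring

theorem gridEnergy_le_of_dvd {n m : ℕ} (f : ℝ → E) (hn : 0 < n) (hm : 0 < m) (h : n ∣ m) :
    gridEnergy n f ≤ gridEnergy m f := by
  have := norm_sq_stepDeriv_sub f hn hm h
  nlinarith [sq_nonneg ‖stepDeriv m f - stepDeriv n f‖]

theorem monotone_gridEnergy_two_pow (f : ℝ → E) : Monotone fun k : ℕ => gridEnergy (2 ^ k) f :=
  fun _ _ h => gridEnergy_le_of_dvd f (by positivity) (by positivity) (pow_dvd_pow 2 h)

/-- The step derivatives along the dyadic grids form a martingale; bounded energies make it converge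
in `L²`. -/
theorem exists_tendsto_stepDeriv {f : ℝ → E} {M : ℝ} (hM : ∀ k : ℕ, gridEnergy (2 ^ k) f ≤ M) :
    ∃ G : Lp E 2 (volume.restrict (Icc (0 : ℝ) 1)), ‖G‖ ^ 2 ≤ M ∧
      Tendsto (fun k : ℕ => stepDeriv (2 ^ k) f) atTop (𝓝 G) := by
  have hmono := monotone_gridEnergy_two_pow f
  have hlim := tendsto_atTop_ciSup hmono ⟨M, by rintro _ ⟨k, rfl⟩; exact hM k⟩
  have hc : CauchySeq fun k : ℕ => stepDeriv (2 ^ k) f := by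
    -- the increments are orthogonal, so their squared norms telescope
    rw [Metric.cauchySeq_iff']
    intro ε hε
    obtain ⟨n, hn⟩ := Metric.cauchySeq_iff'.1 hlim.cauchySeq (ε ^ 2) (by positivity)
    refine ⟨n, fun k hk => ?_⟩
    have h1 := norm_sq_stepDeriv_sub f (by positivity) (by positivity) (pow_dvd_pow 2 hk)
    have h2 := hn k hk
    rw [Real.dist_eq, ← h1, abs_of_nonneg (sq_nonneg _)] at h2
    rw [dist_eq_norm]
    exact lt_of_pow_lt_pow_left₀ 2 hε.le h2
  obtain ⟨G, hG⟩ := cauchySeq_tendsto_of_complete hc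
  refine ⟨G, le_of_tendsto (hG.norm.pow 2) (Eventually.of_forall fun k => ?_), hG⟩
  rw [norm_sq_stepDeriv f (by positivity)]
  exact hM k

/-- The limit of the step derivatives is a derivative of `f` in the integrated sense, at least between
dyadic points. -/
theorem setIntegral_dyadic_of_tendsto {f : ℝ → E} {G : Lp E 2 (volume.restrict (Icc (0 : ℝ) 1))}
    (hG : Tendsto (fun k : ℕ => stepDeriv (2 ^ k) f) atTop (𝓝 G)) {a j : ℕ} (hj : j ≤ 2 ^ a) :
    ∫ x in Ioc 0 ((j : ℕ) / (2 ^ a : ℕ) : ℝ), G x ∂(volume.restrict (Icc (0 : ℝ) 1))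
      = f ((j : ℕ) / (2 ^ a : ℕ)) - f 0 := by
  refine ext_inner_left ℝ fun c => ?_
  rw [← L2.inner_indicatorConstLp_eq_inner_setIntegral ℝ measurableSet_Ioc (measure_ne_top _ _)]
  refine tendsto_nhds_unique (tendsto_const_nhds.inner hG) (tendsto_const_nhds.congr' ?_)
  filter_upwards [eventually_ge_atTop a] with k hk
  rw [L2.inner_indicatorConstLp_eq_inner_setIntegral ℝ]
  have e : ((j : ℕ) : ℝ) / (2 ^ a : ℕ) = ((j * 2 ^ (k - a) : ℕ) : ℝ) / (2 ^ k : ℕ) := by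
    obtain ⟨b, rfl⟩ := Nat.exists_eq_add_of_le hk
    rw [Nat.add_sub_cancel_left, pow_add]
    push_cast
    rw [mul_div_mul_right _ _ (by positivity)]
  have hle : j * 2 ^ (k - a) ≤ 2 ^ k := by
    calc j * 2 ^ (k - a) ≤ 2 ^ a * 2 ^ (k - a) := Nat.mul_le_mul_right _ hj
      _ = 2 ^ k := by rw [← pow_add, Nat.add_sub_cancel' hk]
  have := setIntegral_stepDeriv (2 ^ k) f (Nat.zero_le _) hle
  rw [← e, Nat.cast_zero, zero_div] at this
  rw [this]

end StepDerivative

variable {d : ℕ}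

/-- The path `w`, extended by constants to a function on the line. -/
noncomputable def lineExt (w : C(I, Euc d)) (t : ℝ) : Euc d := w (projIcc 0 1 zero_le_one t)

theorem continuous_lineExt (w : C(I, Euc d)) : Continuous (lineExt w) :=
  w.continuous.comp continuous_projIcc

theorem lineExt_coe (w : C(I, Euc d)) (t : I) : lineExt w t = w t := by
  rw [lineExt, projIcc_val]

theorem continuous_gridEnergy_lineExt (n : ℕ) :
    Continuous fun w : C(I, Euc d) => gridEnergy n (lineExt w) := by
  unfold gridEnergy lineExt
  fun_prop

theorem gridEnergy_nonneg (n : ℕ) (f : ℝ → Euc d) : 0 ≤ gridEnergy n f := by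
  unfold gridEnergy
  positivity

theorem action_le_of_gridEnergy_le {w : C(I, Euc d)} {M : ℝ}
    (hM : ∀ k : ℕ, gridEnergy (2 ^ k) (lineExt w) ≤ M) : action w ≤ ENNReal.ofReal M := by
  obtain ⟨G, hGM, hG⟩ := exists_tendsto_stepDeriv hM
  set g : ℝ → Euc d := (Icc (0 : ℝ) 1).indicator G
  have hgG : g =ᵐ[volume.restrict (Icc 0 1)] G := indicator_ae_eq_restrict measurableSet_Icc
  have hgm : MemLp g 2 (volume.restrict (Icc 0 1)) := (memLp_congr_ae hgG).2 (Lp.memLp G)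
  have hgi : Integrable g volume := by
    rw [integrable_indicator_iff measurableSet_Icc]
    exact (Lp.memLp G).integrable one_le_two
  have hcont : Continuous fun t : ℝ => ∫ r in (0 : ℝ)..t, g r :=
    intervalIntegral.continuous_primitive (fun _ _ => hgi.intervalIntegrable) 0
  -- `g` is a derivative of `w` at dyadic times, hence at all times by continuity of both sides
  have hdy : ∀ a j : ℕ, j ≤ 2 ^ a → ∫ r in (0 : ℝ)..((j : ℕ) / (2 ^ a : ℕ)), g r
      = lineExt w ((j : ℕ) / (2 ^ a : ℕ)) - lineExt w 0 := by
    intro a j hj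
    rw [← setIntegral_dyadic_of_tendsto hG hj, intervalIntegral.integral_of_le (by positivity),
      integral_indicator measurableSet_Icc, Measure.restrict_restrict measurableSet_Icc,
      Measure.restrict_restrict measurableSet_Ioc, inter_comm]
  have hprim : ∀ t : I, w t = w 0 + ∫ r in (0 : ℝ)..t, g r := by
    intro t
    have hlim : Tendsto (fun a : ℕ => ((⌊(t : ℝ) * (2 ^ a : ℕ)⌋₊ : ℕ) : ℝ) / (2 ^ a : ℕ)) atTop
        (𝓝 t) :=
      (tendsto_nat_floor_mul_div_atTop t.2.1).comp
        (tendsto_natCast_atTop_atTop.comp (tendsto_pow_atTop_atTop_of_one_lt one_lt_two))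
    have h1 := (hcont.tendsto _).comp hlim
    have h2 := (((continuous_lineExt w).tendsto (t : ℝ)).comp hlim).sub_const (lineExt w 0)
    have h3 : ∫ r in (0 : ℝ)..t, g r = lineExt w t - lineExt w 0 := by
      refine tendsto_nhds_unique h1 (h2.congr fun a => (hdy a _ ?_).symm)
      refine Nat.floor_le_of_le ?_
      exact mul_le_of_le_one_left (by positivity) t.2.2
    have h4 : lineExt w 0 = w 0 := lineExt_coe w 0
    rw [h3, h4, lineExt_coe]
    abel
  unfold action
  refine (iInf_le _ g).trans ((iInf_le _ hgm).trans ((iInf_le _ hprim).trans ?_))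
  rw [lintegral_congr_ae (g := fun r => ‖G r‖ₑ ^ 2) (by
    filter_upwards [hgG] with r hr; rw [hr])]
  rw [lintegral_enorm_sq_Lp]
  exact ENNReal.ofReal_le_ofReal hGM

/-- The action is dominated by (in fact equal to) the supremum of the energies along the dyadic
grids, each of which is continuous for the uniform topology: this makes the action lower
semicontinuous. -/
theorem action_le_iSup_gridEnergy (w : C(I, Euc d)) :
    action w ≤ ⨆ k : ℕ, ENNReal.ofReal (gridEnergy (2 ^ k) (lineExt w)) := by
  by_cases h : (⨆ k : ℕ, ENNReal.ofReal (gridEnergy (2 ^ k) (lineExt w))) = ⊤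
  · rw [h]; exact le_top
  · rw [← ENNReal.ofReal_toReal h]
    refine action_le_of_gridEnergy_le fun k => ?_
    rw [← ENNReal.ofReal_le_iff_le_toReal h]
    exact le_iSup (fun k : ℕ => ENNReal.ofReal (gridEnergy (2 ^ k) (lineExt w))) k

/-! ### Energy of piecewise linear paths -/

/-- The ramp `x ↦ min (max x 0) 1`. -/
noncomputable def ramp (x : ℝ) : ℝ := max 0 (min 1 x)

theorem ramp_nonneg (x : ℝ) : 0 ≤ ramp x := le_max_left _ _

theorem ramp_le_one (x : ℝ) : ramp x ≤ 1 := max_le zero_le_one (min_le_left _ _)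

theorem ramp_mono : Monotone ramp := fun _ _ h => max_le_max le_rfl (min_le_min le_rfl h)

theorem ramp_of_nonpos {x : ℝ} (h : x ≤ 0) : ramp x = 0 :=
  max_eq_left ((min_le_right _ _).trans h)

theorem ramp_of_one_le {x : ℝ} (h : 1 ≤ x) : ramp x = 1 := by
  rw [ramp, min_eq_left h, max_eq_right zero_le_one]

theorem hat_eq_ramp_sub (x : ℝ) : max 0 (1 - |x|) = ramp (x + 1) - ramp x := by
  unfold ramp
  rcases le_total x 0 with h | h
  · rw [abs_of_nonpos h, min_eq_right (by linarith : x + 1 ≤ 1), min_eq_right (by linarith),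
      max_eq_left h]
    ring_nf
  · rw [abs_of_nonneg h, min_eq_left (by linarith : 1 ≤ x + 1), max_eq_right zero_le_one]
    rcases le_total x 1 with h' | h'
    · rw [min_eq_right h', max_eq_right h, max_eq_right (by linarith)]
    · rw [min_eq_left h', max_eq_right zero_le_one, max_eq_left (by linarith), sub_self]

theorem sum_ramp (T : ℕ) {x : ℝ} (hx : 0 ≤ x) :
    ∑ i ∈ Finset.range T, ramp (x - i) = min x T := by
  induction T with
  | zero => simp [hx]
  | succ T ih =>
    rw [Finset.sum_range_succ, ih]
    push_cast
    rcases le_total x T with h | h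
    · rw [ramp_of_nonpos (by linarith), min_eq_left h, min_eq_left (by linarith), add_zero]
    · rw [min_eq_right h]
      unfold ramp
      rcases le_total x (T + 1) with h' | h'
      · rw [min_eq_right (by linarith), max_eq_right (by linarith), min_eq_left h']
        ring
      · rw [min_eq_left (by linarith), max_eq_right zero_le_one, min_eq_right h']

/-- Summation by parts: a piecewise linear path accumulates its successive increments, the `i`-th
one during `[i / T, (i + 1) / T]`. -/
theorem plPath_eq_add_sum {T : ℕ} (v : Fin (T + 1) → Euc d) (t : I) :
    plPath v t = v 0 + ∑ i : Fin T,
      ramp (T * t - ((i : ℕ) : ℝ)) • (v i.succ - v i.castSucc) := by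
  change ∑ i : Fin (T + 1), max 0 (1 - |(T : ℝ) * (t : ℝ) - ((i : ℕ) : ℝ)|) • v i = _
  have h0 : (0 : ℝ) ≤ T * t := mul_nonneg (Nat.cast_nonneg _) t.2.1
  have h1 : (T : ℝ) * t ≤ T := mul_le_of_le_one_right (Nat.cast_nonneg _) t.2.2
  simp_rw [hat_eq_ramp_sub, sub_smul, smul_sub, Finset.sum_sub_distrib]
  rw [Fin.sum_univ_succ, Fin.sum_univ_castSucc (fun i : Fin (T + 1) => ramp (_ - _) • v i)]
  simp only [Fin.val_zero, Fin.val_succ, Fin.val_castSucc, Fin.val_last]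
  rw [ramp_of_one_le (x := _ + 1) (by push_cast; linarith), ramp_of_nonpos (by linarith), one_smul,
    zero_smul, add_zero, add_sub_assoc]
  congr 3
  ext i
  push_cast
  ring_nf

/-- The energy `T ∑ |v_{i+1} - v_i|²` of a chain of points: the action of the piecewise linear
path through them. -/
noncomputable def chainEnergy {T : ℕ} (v : Fin (T + 1) → Euc d) : ℝ :=
  T * ∑ i : Fin T, ‖v i.succ - v i.castSucc‖ ^ 2

theorem chainEnergy_nonneg {T : ℕ} (v : Fin (T + 1) → Euc d) : 0 ≤ chainEnergy v := by
  unfold chainEnergy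
  positivity

/-- Cauchy-Schwarz on the increment of a piecewise linear path. Apart from the factor `t - s`, the
right side telescopes when summed over consecutive time intervals. -/
theorem norm_sq_plPath_sub_le {T : ℕ} (v : Fin (T + 1) → Euc d) {s t : I} (hst : s ≤ t) :
    ‖plPath v t - plPath v s‖ ^ 2 ≤ T * (t - s) * ∑ i : Fin T,
      (ramp (T * t - ((i : ℕ) : ℝ)) - ramp (T * s - ((i : ℕ) : ℝ)))
        * ‖v i.succ - v i.castSucc‖ ^ 2 := by
  have hT : (0 : ℝ) ≤ T := Nat.cast_nonneg _
  set p : Fin T → ℝ := fun i =>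
    ramp (T * t - ((i : ℕ) : ℝ)) - ramp (T * s - ((i : ℕ) : ℝ)) with hp
  have hst' : (s : ℝ) ≤ t := hst
  have hp0 : ∀ i, 0 ≤ p i := fun i => sub_nonneg.2 (ramp_mono (by gcongr))
  have hsum : ∀ r : I, ∑ i : Fin T, ramp (T * r - ((i : ℕ) : ℝ)) = T * r := by
    intro r
    rw [Fin.sum_univ_eq_sum_range (fun i : ℕ => ramp (T * r - (i : ℝ))),
      sum_ramp _ (mul_nonneg hT r.2.1), min_eq_left (mul_le_of_le_one_right hT r.2.2)]
  have hpsum : ∑ i, p i = T * (t - s) := by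
    rw [hp, Finset.sum_sub_distrib, hsum, hsum]; ring
  have hdiff : plPath v t - plPath v s = ∑ i : Fin T, p i • (v i.succ - v i.castSucc) := by
    rw [plPath_eq_add_sum, plPath_eq_add_sum, add_sub_add_left_eq_sub, ← Finset.sum_sub_distrib]
    simp_rw [← sub_smul]
    rfl
  rw [hdiff, ← hpsum]
  calc ‖∑ i : Fin T, p i • (v i.succ - v i.castSucc)‖ ^ 2
      ≤ (∑ i : Fin T, p i * ‖v i.succ - v i.castSucc‖) ^ 2 := by
        gcongr
        refine (norm_sum_le _ _).trans_eq (Finset.sum_congr rfl fun i _ => ?_)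
        rw [norm_smul, Real.norm_of_nonneg (hp0 i)]
    _ ≤ _ := by
        refine Finset.sum_sq_le_sum_mul_sum_of_sq_le_mul _ (fun i _ => hp0 i)
          (fun i _ => mul_nonneg (hp0 i) (sq_nonneg _)) fun i _ => ?_
        exact le_of_eq (by ring)

theorem norm_sq_plPath_sub_le_dist {T : ℕ} (v : Fin (T + 1) → Euc d) (s t : I) :
    ‖plPath v t - plPath v s‖ ^ 2 ≤ dist s t * chainEnergy v := by
  wlog hst : s ≤ t generalizing s t
  · rw [norm_sub_rev, dist_comm]
    exact this t s (le_of_not_ge hst)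
  have hst' : (s : ℝ) ≤ t := hst
  refine (norm_sq_plPath_sub_le v hst).trans ?_
  rw [dist_comm, Subtype.dist_eq, Real.dist_eq, abs_of_nonneg (sub_nonneg.2 hst'), chainEnergy,
    mul_comm (T : ℝ), mul_assoc]
  have : ∀ i : Fin T, (ramp (T * t - ((i : ℕ) : ℝ)) - ramp (T * s - ((i : ℕ) : ℝ)))
        * ‖v i.succ - v i.castSucc‖ ^ 2 ≤ ‖v i.succ - v i.castSucc‖ ^ 2 := fun i =>
    mul_le_of_le_one_left (sq_nonneg _) (by
      linarith [ramp_le_one (T * t - ((i : ℕ) : ℝ)), ramp_nonneg (T * s - ((i : ℕ) : ℝ))])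
  have h0 : 0 ≤ (t : ℝ) - s := sub_nonneg.2 hst'
  gcongr with i _
  exact this i

theorem gridEnergy_plPath_le {T : ℕ} (v : Fin (T + 1) → Euc d) (n : ℕ) :
    gridEnergy n (lineExt (plPath v)) ≤ chainEnergy v := by
  rcases Nat.eq_zero_or_pos n with rfl | hn
  · simpa [gridEnergy] using chainEnergy_nonneg v
  have hn' : (0 : ℝ) < n := by exact_mod_cast hn
  have hT : (0 : ℝ) ≤ T := Nat.cast_nonneg _
  have hmem : ∀ k : ℕ, k ≤ n → ((k : ℕ) : ℝ) / n ∈ Icc (0 : ℝ) 1 := fun k hk =>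
    ⟨by positivity, by rw [div_le_one hn']; exact_mod_cast hk⟩
  have hstep : ∀ k ∈ Finset.range n,
      ‖lineExt (plPath v) ((k + 1 : ℕ) / n) - lineExt (plPath v) ((k : ℕ) / n)‖ ^ 2
        ≤ T * (1 / n) * ∑ i : Fin T,
          (ramp (T * (((k + 1 : ℕ) : ℝ) / n) - ((i : ℕ) : ℝ))
            - ramp (T * (((k : ℕ) : ℝ) / n) - ((i : ℕ) : ℝ))) * ‖v i.succ - v i.castSucc‖ ^ 2 := by
    intro k hk
    rw [Finset.mem_range] at hk
    have h := norm_sq_plPath_sub_le v (s := ⟨_, hmem k hk.le⟩) (t := ⟨_, hmem (k + 1) hk⟩)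
      (Subtype.mk_le_mk.2 (by gcongr; omega))
    rw [lineExt, lineExt, projIcc_of_mem _ (hmem k hk.le), projIcc_of_mem _ (hmem (k + 1) hk)]
    refine h.trans_eq ?_
    congr 2
    push_cast
    ring
  calc gridEnergy n (lineExt (plPath v))
      ≤ n * ∑ k ∈ Finset.range n, T * (1 / n) * ∑ i : Fin T,
          (ramp (T * (((k + 1 : ℕ) : ℝ) / n) - ((i : ℕ) : ℝ))
            - ramp (T * (((k : ℕ) : ℝ) / n) - ((i : ℕ) : ℝ)))
            * ‖v i.succ - v i.castSucc‖ ^ 2 := by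
        unfold gridEnergy
        gcongr with k hk
        exact hstep k hk
    _ = T * ∑ i : Fin T, (ramp (T * ((n : ℝ) / n) - ((i : ℕ) : ℝ))
          - ramp (T * (((0 : ℕ) : ℝ) / n) - ((i : ℕ) : ℝ))) * ‖v i.succ - v i.castSucc‖ ^ 2 := by
        rw [← Finset.mul_sum, Finset.sum_comm, ← mul_assoc]
        congr 1
        · field_simp
        · refine Finset.sum_congr rfl fun i _ => ?_
          rw [← Finset.sum_mul,
            Finset.sum_range_sub (fun k : ℕ => ramp (T * (((k : ℕ) : ℝ) / n) - ((i : ℕ) : ℝ)))]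
    _ ≤ chainEnergy v := by
        unfold chainEnergy
        gcongr with i _
        refine mul_le_of_le_one_left (sq_nonneg _) ?_
        linarith [ramp_le_one (T * ((n : ℝ) / n) - ((i : ℕ) : ℝ)),
          ramp_nonneg (T * (((0 : ℕ) : ℝ) / n) - ((i : ℕ) : ℝ))]

/-! ### Piecewise linear flows as laws of random paths -/

theorem isProbabilityMeasure_leb {X : Set (Euc d)} (hX : IsCompact X) (hX₀ : volume X ≠ 0) :
    IsProbabilityMeasure (leb X) :=
  ⟨by rw [leb, Measure.smul_apply, Measure.restrict_apply_univ, smul_eq_mul,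
    ENNReal.inv_mul_cancel hX₀ hX.measure_ne_top]⟩

/-- The law of a random variable which is constant on the cells of an equipartition. -/
theorem map_leb_eq_sum_dirac {X : Set (Euc d)} {C : ℝ} {N : ℕ} {P : Fin N → Set (Euc d)}
    (hP : IsEquipartition X C P) {β : Type*} [MeasurableSpace β] {Φ : Euc d → β}
    (hΦ : AEMeasurable Φ (leb X)) {c : Fin N → β}
    (hc : ∀ j, ∀ᵐ x ∂(leb X), x ∈ P j → Φ x = c j) :
    (leb X).map Φ = (N : ℝ≥0∞)⁻¹ • ∑ j : Fin N, Measure.dirac (c j) := by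
  have hXm : MeasurableSet X := hP.iUnion_eq ▸ MeasurableSet.iUnion hP.measurableSet
  have hdec : leb X = ∑ j : Fin N, (leb X).restrict (P j) := by
    rw [← Measure.sum_fintype, ← Measure.restrict_iUnion hP.pairwise_disjoint hP.measurableSet,
      hP.iUnion_eq, leb, Measure.restrict_smul, Measure.restrict_restrict hXm, inter_self]
  ext s hs
  rw [Measure.map_apply_of_aemeasurable hΦ hs]
  conv_lhs => rw [hdec]
  rw [Measure.finsetSum_apply, Measure.smul_apply, Measure.finsetSum_apply, smul_eq_mul,
    Finset.mul_sum]
  refine Finset.sum_congr rfl fun j _ => ?_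
  have hae : Φ =ᵐ[(leb X).restrict (P j)] fun _ => c j :=
    (ae_restrict_iff' (hP.measurableSet j)).2 (hc j)
  rw [← Measure.map_apply_of_aemeasurable (hΦ.mono_measure Measure.restrict_le_self) hs,
    Measure.map_congr hae, Measure.map_const, Measure.restrict_apply_univ, hP.area j,
    Measure.smul_apply, smul_eq_mul]

theorem continuous_plPath {T : ℕ} :
    Continuous (plPath : (Fin (T + 1) → Euc d) → C(I, Euc d)) := by
  refine ContinuousMap.continuous_of_continuous_uncurry _ ?_
  change Continuous fun p : (Fin (T + 1) → Euc d) × I =>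
    ∑ i : Fin (T + 1), max 0 (1 - |(T : ℝ) * (p.2 : ℝ) - ((i : ℕ) : ℝ)|) • p.1 i
  fun_prop

theorem aemeasurable_chain {X : Set (Euc d)} {T : ℕ} (m : Fin (T + 1) → MM X) :
    AEMeasurable (fun x i => m i x) (leb X) :=
  aemeasurable_pi_lambda _ fun i => (Lp.aestronglyMeasurable (m i)).aemeasurable

theorem aemeasurable_plPath {X : Set (Euc d)} {T : ℕ} (m : Fin (T + 1) → MM X) :
    AEMeasurable (fun x => plPath fun i => m i x) (leb X) :=
  continuous_plPath.measurable.comp_aemeasurable (aemeasurable_chain m)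

/-- The flow associated with the chain `m` is the law, under the normalized Lebesgue measure, of
the random path `x ↦ plPath (m · x)`. -/
theorem plFlowMeasure_eq_map {X : Set (Euc d)} {C : ℝ} {T N : ℕ} {P : Fin N → Set (Euc d)}
    (hP : IsEquipartition X C P) (m : Fin (T + 1) → MN X P) :
    plFlowMeasure m = (leb X).map fun x => plPath fun i => (m i : MM X) x := by
  refine (map_leb_eq_sum_dirac hP (aemeasurable_plPath fun i => (m i : MM X)) fun j => ?_).symm
  have h : ∀ i, ∀ᵐ x ∂(leb X), x ∈ P j → (m i : MM X) x = cellValue (m i) j := fun i =>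
    ((m i).2 j).choose_spec
  filter_upwards [ae_all_iff.2 h] with x hx hxj
  congr 1
  ext1 i
  exact hx i hxj

theorem continuous_eval (t : I) : Continuous fun w : C(I, Euc d) => w t :=
  continuous_eval_const t

theorem map_eval_plFlowMeasure {X : Set (Euc d)} {C : ℝ} {T N : ℕ} {P : Fin N → Set (Euc d)}
    (hP : IsEquipartition X C P) (m : Fin (T + 1) → MN X P) (i : Fin T) {a : ℝ} (ha₀ : 0 ≤ a)
    (ha₁ : a ≤ 1) {t : I} (ht : (T : ℝ) * t = (i : ℕ) + a) :
    (plFlowMeasure m).map (fun w => w t)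
      = (leb X).map ((1 - a) • (m i.castSucc : MM X) + a • (m i.succ : MM X) : MM X) := by
  rw [plFlowMeasure_eq_map hP, AEMeasurable.map_map_of_aemeasurable
    (continuous_eval t).measurable.aemeasurable (aemeasurable_plPath fun i => (m i : MM X))]
  refine Measure.map_congr ?_
  filter_upwards [Lp.coeFn_add ((1 - a) • (m i.castSucc : MM X)) (a • (m i.succ : MM X)),
    Lp.coeFn_smul (1 - a) (m i.castSucc : MM X), Lp.coeFn_smul a (m i.succ : MM X)] with x h1 h2 h3
  rw [h1, Pi.add_apply, h2, h3, Function.comp_apply, plPath_apply _ i a ha₀ ha₁ t ht]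
  rfl

theorem lintegral_chainEnergy {X : Set (Euc d)} {T : ℕ} (m : Fin (T + 1) → MM X) :
    ∫⁻ x, ENNReal.ofReal (chainEnergy fun i => m i x) ∂(leb X)
      = ENNReal.ofReal (T * ∑ i : Fin T, ‖m i.succ - m i.castSucc‖ ^ 2) := by
  have h : ∀ x, ENNReal.ofReal (chainEnergy fun i => m i x)
      = T * ∑ i : Fin T, ‖m i.succ x - m i.castSucc x‖ₑ ^ 2 := by
    intro x
    rw [chainEnergy, ENNReal.ofReal_mul (Nat.cast_nonneg _), ENNReal.ofReal_natCast,
      ENNReal.ofReal_sum_of_nonneg fun _ _ => sq_nonneg _]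
    simp_rw [ENNReal.ofReal_pow (norm_nonneg _), ofReal_norm]
  have hm : ∀ i, AEMeasurable (fun x => m i x) (leb X) := fun i =>
    (Lp.aestronglyMeasurable (m i)).aemeasurable
  simp_rw [h]
  rw [lintegral_const_mul' _ _ (ENNReal.natCast_ne_top T), lintegral_finsetSum' _ fun i _ =>
    (((hm i.succ).sub (hm i.castSucc)).enorm.pow_const 2), ENNReal.ofReal_mul (Nat.cast_nonneg _),
    ENNReal.ofReal_natCast, ENNReal.ofReal_sum_of_nonneg fun _ _ => sq_nonneg _]
  congr 1
  refine Finset.sum_congr rfl fun i _ => ?_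
  rw [← lintegral_enorm_sq_Lp]
  refine lintegral_congr_ae ?_
  filter_upwards [Lp.coeFn_sub (m i.succ) (m i.castSucc)] with x hx
  rw [hx, Pi.sub_apply]

/-! ### The discrete problem -/

theorem sum_univ_eq_ends_add_Ioo {T : ℕ} (hT : 0 < T) (F : Fin (T + 1) → ℝ) :
    ∑ i, F i = F 0 + F (Fin.last T) + ∑ i ∈ Finset.Ioo 0 (Fin.last T), F i := by
  have h0 : (0 : Fin (T + 1)) ∉ Finset.Ioo 0 (Fin.last T) := by simp
  have h1 : Fin.last T ∉ Finset.Ioo 0 (Fin.last T) := by simp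
  have hne : (0 : Fin (T + 1)) ≠ Fin.last T := by
    rw [Ne, Fin.ext_iff]; simp; omega
  have huniv : (Finset.univ : Finset (Fin (T + 1)))
      = insert 0 (insert (Fin.last T) (Finset.Ioo 0 (Fin.last T))) := by
    ext i
    simp only [Finset.mem_univ, Finset.mem_insert, Finset.mem_Ioo, true_iff]
    by_cases h : i = 0
    · exact Or.inl h
    · by_cases h' : i = Fin.last T
      · exact Or.inr (Or.inl h')
      · exact Or.inr (Or.inr ⟨Fin.pos_iff_ne_zero.2 h, Fin.lt_last_iff_ne_last.2 h'⟩)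
  rw [huniv, Finset.sum_insert, Finset.sum_insert h1]
  · ring
  · simp [hne]

/-- The terms penalized by `lam` in the discrete functional: the squared distance to `s₀` at the first
index, to `s₁` at the last one, to `𝕊` in between. -/
noncomputable def defect (X : Set (Euc d)) (s₀ s₁ : MM X) {T : ℕ} (m : Fin (T + 1) → MM X)
    (i : Fin (T + 1)) : ℝ :=
  if i = 0 then ‖m 0 - s₀‖ ^ 2 else if i = Fin.last T then ‖m (Fin.last T) - s₁‖ ^ 2
    else ⨅ s : SS X, ‖m i - s‖ ^ 2

theorem discreteFunctional_eq {X : Set (Euc d)} {s₀ s₁ : MM X} {T : ℕ} (hT : 0 < T) (lam : ℝ)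
    (m : Fin (T + 1) → MM X) :
    discreteFunctional X s₀ s₁ lam m
      = T * ∑ i : Fin T, ‖m i.succ - m i.castSucc‖ ^ 2 + lam * ∑ i, defect X s₀ s₁ m i := by
  have hne : Fin.last T ≠ 0 := by
    rw [Ne, Fin.ext_iff]; simp; omega
  rw [discreteFunctional, sum_univ_eq_ends_add_Ioo hT]
  have h : ∀ i ∈ Finset.Ioo 0 (Fin.last T),
      defect X s₀ s₁ m i = ⨅ s : SS X, ‖m i - s‖ ^ 2 := by
    intro i hi
    rw [Finset.mem_Ioo] at hi
    rw [defect, if_neg hi.1.ne', if_neg hi.2.ne]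
  rw [Finset.sum_congr rfl h, defect, defect, if_pos rfl, if_neg hne, if_pos rfl]

theorem infDist_sq_le_defect {X : Set (Euc d)} {s₀ s₁ : MM X} (hs₀ : s₀ ∈ SS X) (hs₁ : s₁ ∈ SS X)
    {T : ℕ} (m : Fin (T + 1) → MM X) (i : Fin (T + 1)) :
    Metric.infDist (m i) (SS X) ^ 2 ≤ defect X s₀ s₁ m i := by
  have key : ∀ s ∈ SS X, Metric.infDist (m i) (SS X) ^ 2 ≤ ‖m i - s‖ ^ 2 := by
    intro s hs
    rw [← dist_eq_norm]
    gcongr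
    · exact Metric.infDist_nonneg
    · exact Metric.infDist_le_dist_of_mem hs
  rw [defect]
  split_ifs with h h'
  · subst h; exact key _ hs₀
  · subst h'; exact key _ hs₁
  · have : Nonempty (SS X) := ⟨⟨s₀, hs₀⟩⟩
    exact le_ciInf fun s => key _ s.2

theorem defect_nonneg {X : Set (Euc d)} {s₀ s₁ : MM X} (hs₀ : s₀ ∈ SS X) (hs₁ : s₁ ∈ SS X)
    {T : ℕ} (m : Fin (T + 1) → MM X) (i : Fin (T + 1)) : 0 ≤ defect X s₀ s₁ m i :=
  (sq_nonneg _).trans (infDist_sq_le_defect hs₀ hs₁ m i)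

theorem IsDiscreteMinimizer.discreteEnergy_eq {X : Set (Euc d)} {s₀ s₁ : MM X} {T N : ℕ}
    {P : Fin N → Set (Euc d)} {lam : ℝ} {m : Fin (T + 1) → MN X P}
    (hm : IsDiscreteMinimizer X s₀ s₁ lam m) :
    discreteEnergy X s₀ s₁ T P lam = discreteFunctional X s₀ s₁ lam fun i => (m i : MM X) :=
  le_antisymm (ciInf_le ⟨_, by rintro _ ⟨m', rfl⟩; exact hm m'⟩ m) (le_ciInf hm)

/-! ### The classical construction -/

theorem add_sq_le_weighted {c : ℝ} (hc : 0 < c) (a b : ℝ) :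
    (a + b) ^ 2 ≤ (1 + c) * (a ^ 2 + b ^ 2 / c) := by
  have h : (1 + c) * (a ^ 2 + b ^ 2 / c) - (a + b) ^ 2 = (c * a - b) ^ 2 / c := by
    field_simp
    ring
  have : 0 ≤ (c * a - b) ^ 2 / c := by positivity
  linarith

/-- Moving the points of a chain costs at most the weighted sum of its energy and of the squared
displacements. -/
theorem chain_energy_le_of_perturbation {H : Type*} [NormedAddCommGroup H] {T : ℕ} (hT : 0 < T)
    {lam : ℝ} (hlam : 0 < lam) (m s : Fin (T + 1) → H) :
    T * ∑ i : Fin T, ‖s i.succ - s i.castSucc‖ ^ 2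
      ≤ (1 + 4 * T / lam) * (T * ∑ i : Fin T, ‖m i.succ - m i.castSucc‖ ^ 2
        + lam * ∑ i, ‖m i - s i‖ ^ 2) := by
  have hT' : (0 : ℝ) < T := by exact_mod_cast hT
  set c : ℝ := 4 * T / lam with hc_def
  have hc : 0 < c := by positivity
  have hstep : ∀ i : Fin T, ‖s i.succ - s i.castSucc‖ ^ 2 ≤ (1 + c) *
      (‖m i.succ - m i.castSucc‖ ^ 2
        + 2 * (‖m i.succ - s i.succ‖ ^ 2 + ‖m i.castSucc - s i.castSucc‖ ^ 2) / c) := by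
    intro i
    have h1 : ‖s i.succ - s i.castSucc‖ ≤ ‖m i.succ - m i.castSucc‖
        + (‖m i.succ - s i.succ‖ + ‖m i.castSucc - s i.castSucc‖) := by
      have : s i.succ - s i.castSucc = (m i.succ - m i.castSucc)
          - (m i.succ - s i.succ) + (m i.castSucc - s i.castSucc) := by abel
      rw [this]
      refine (norm_add_le _ _).trans ?_
      linarith [norm_sub_le (m i.succ - m i.castSucc) (m i.succ - s i.succ)]
    refine (pow_le_pow_left₀ (norm_nonneg _) h1 2).trans ((add_sq_le_weighted hc _ _).trans ?_)
    gcongr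
    exact add_sq_le
  have hsum1 : ∑ i : Fin T, ‖m i.succ - s i.succ‖ ^ 2 ≤ ∑ i, ‖m i - s i‖ ^ 2 := by
    rw [Fin.sum_univ_succ (fun i => ‖m i - s i‖ ^ 2)]
    linarith [sq_nonneg ‖m 0 - s 0‖]
  have hsum2 : ∑ i : Fin T, ‖m i.castSucc - s i.castSucc‖ ^ 2 ≤ ∑ i, ‖m i - s i‖ ^ 2 := by
    rw [Fin.sum_univ_castSucc (fun i => ‖m i - s i‖ ^ 2)]
    linarith [sq_nonneg ‖m (Fin.last T) - s (Fin.last T)‖]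
  calc T * ∑ i : Fin T, ‖s i.succ - s i.castSucc‖ ^ 2
      ≤ T * ∑ i : Fin T, (1 + c) * (‖m i.succ - m i.castSucc‖ ^ 2
        + 2 * (‖m i.succ - s i.succ‖ ^ 2 + ‖m i.castSucc - s i.castSucc‖ ^ 2) / c) := by
        gcongr with i _
        exact hstep i
    _ = (1 + c) * (T * ∑ i : Fin T, ‖m i.succ - m i.castSucc‖ ^ 2
        + T * 2 / c * (∑ i : Fin T, ‖m i.succ - s i.succ‖ ^ 2
          + ∑ i : Fin T, ‖m i.castSucc - s i.castSucc‖ ^ 2)) := by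
        rw [← Finset.mul_sum, Finset.sum_add_distrib, ← Finset.sum_add_distrib (f := fun i : Fin T =>
          ‖m i.succ - s i.succ‖ ^ 2), ← Finset.sum_div, ← Finset.mul_sum]
        ring
    _ ≤ (1 + c) * (T * ∑ i : Fin T, ‖m i.succ - m i.castSucc‖ ^ 2
        + T * 2 / c * (∑ i, ‖m i - s i‖ ^ 2 + ∑ i, ‖m i - s i‖ ^ 2)) := by
        gcongr
    _ = _ := by
        rw [hc_def]
        field_simp
        ring

theorem classical_construction {X : Set (Euc d)} {s₀ s₁ : MM X} (hs₀ : s₀ ∈ SS X) {T N : ℕ}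
    (hT : 0 < T) {P : Fin N → Set (Euc d)} {lam : ℝ} (hlam : 0 < lam) {m : Fin (T + 1) → MN X P}
    (hm : IsDiscreteMinimizer X s₀ s₁ lam m) {s : Fin (T + 1) → MM X} (h0 : s 0 = s₀)
    (h1 : s (Fin.last T) = s₁) (hs : ∀ i, 0 < i → i < Fin.last T → IsProjSS X (m i) (s i)) :
    T * ∑ i : Fin T, ‖s i.succ - s i.castSucc‖ ^ 2 ≤ discreteEnergy' X s₀ s₁ T P lam := by
  rw [discreteEnergy', hm.discreteEnergy_eq, discreteFunctional_eq hT]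
  refine (chain_energy_le_of_perturbation hT hlam (fun i => (m i : MM X)) s).trans ?_
  gcongr with i _
  rw [defect]
  split_ifs with h h'
  · rw [h, h0]
  · rw [h', h1]
  · have : Nonempty (SS X) := ⟨⟨s₀, hs₀⟩⟩
    refine le_ciInf fun s' => ?_
    gcongr
    exact (hs i (Fin.pos_iff_ne_zero.2 h) (Fin.lt_last_iff_ne_last.2 h')).2 s' s'.2

/-! ### The relaxed construction -/

theorem W2sq_map_le {X : Set (Euc d)} (f : MM X) {s : MM X} (hs : s ∈ SS X) :
    W2sq ((leb X).map f) (leb X) ≤ ENNReal.ofReal (‖f - s‖ ^ 2) := by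
  have hfm : AEMeasurable f (leb X) := (Lp.aestronglyMeasurable f).aemeasurable
  have hsm : AEMeasurable s (leb X) := (Lp.aestronglyMeasurable s).aemeasurable
  have h1 : ((leb X).map fun x => (f x, s x)).map Prod.fst = (leb X).map f := by
    rw [AEMeasurable.map_map_of_aemeasurable measurable_fst.aemeasurable (hfm.prodMk hsm)]
    rfl
  have h2 : ((leb X).map fun x => (f x, s x)).map Prod.snd = leb X := by
    rw [AEMeasurable.map_map_of_aemeasurable measurable_snd.aemeasurable (hfm.prodMk hsm)]
    exact hs
  unfold W2sq
  refine (iInf_le _ _).trans ((iInf_le _ h1).trans ((iInf_le _ h2).trans ?_))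
  rw [lintegral_map' (by fun_prop) (hfm.prodMk hsm), ← lintegral_enorm_sq_Lp]
  refine le_of_eq (lintegral_congr_ae ?_)
  filter_upwards [Lp.coeFn_sub f s] with x hx
  rw [hx, Pi.sub_apply, edist_eq_enorm_sub]

theorem W2sq_map_le_infDist {X : Set (Euc d)} (hne : (SS X).Nonempty) (f : MM X) :
    W2sq ((leb X).map f) (leb X) ≤ ENNReal.ofReal (Metric.infDist f (SS X) ^ 2) := by
  have h : ∀ r > Metric.infDist f (SS X),
      W2sq ((leb X).map f) (leb X) ≤ ENNReal.ofReal (r ^ 2) := by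
    intro r hr
    obtain ⟨s, hs, hlt⟩ := (Metric.infDist_lt_iff hne).1 hr
    rw [dist_eq_norm] at hlt
    exact (W2sq_map_le f hs).trans (ENNReal.ofReal_le_ofReal (by gcongr))
  refine ge_of_tendsto (x := 𝓝[>] (Metric.infDist f (SS X)))
    (f := fun r : ℝ => ENNReal.ofReal (r ^ 2)) ?_ (eventually_nhdsWithin_of_forall h)
  exact ((ENNReal.continuous_ofReal.comp (continuous_pow 2)).tendsto _).mono_left
    nhdsWithin_le_nhds

/-- The squared distance from a point of a segment to a set: compare with both endpoints, with
weights `1 - a` and `a`. -/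
theorem infDist_sq_segment_le {H : Type*} [NormedAddCommGroup H] [NormedSpace ℝ H] (S : Set H)
    {c : ℝ} (hc : 0 < c) {a : ℝ} (ha₀ : 0 ≤ a) (ha₁ : a ≤ 1) (x y : H) :
    Metric.infDist ((1 - a) • x + a • y) S ^ 2 ≤ (1 + c) * (‖y - x‖ ^ 2 / 4
      + ((1 - a) * Metric.infDist x S ^ 2 + a * Metric.infDist y S ^ 2) / c) := by
  set D := Metric.infDist ((1 - a) • x + a • y) S with hD
  have hD0 : 0 ≤ D := Metric.infDist_nonneg
  have hx : D ≤ a * ‖y - x‖ + Metric.infDist x S := by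
    refine (Metric.infDist_le_infDist_add_dist (y := x)).trans ?_
    rw [dist_eq_norm, add_comm]
    have : (1 - a) • x + a • y - x = a • (y - x) := by module
    rw [this, norm_smul, Real.norm_of_nonneg ha₀]
  have hy : D ≤ (1 - a) * ‖y - x‖ + Metric.infDist y S := by
    refine (Metric.infDist_le_infDist_add_dist (y := y)).trans ?_
    rw [dist_eq_norm, add_comm]
    have : (1 - a) • x + a • y - y = (1 - a) • (x - y) := by module
    rw [this, norm_smul, Real.norm_of_nonneg (by linarith), norm_sub_rev]
  have hx2 := (pow_le_pow_left₀ hD0 hx 2).trans (add_sq_le_weighted hc _ _)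
  have hy2 := (pow_le_pow_left₀ hD0 hy 2).trans (add_sq_le_weighted hc _ _)
  calc D ^ 2 = (1 - a) * D ^ 2 + a * D ^ 2 := by ring
    _ ≤ (1 - a) * ((1 + c) * ((a * ‖y - x‖) ^ 2 + Metric.infDist x S ^ 2 / c))
        + a * ((1 + c) * (((1 - a) * ‖y - x‖) ^ 2 + Metric.infDist y S ^ 2 / c)) := by
        have : 0 ≤ 1 - a := by linarith
        gcongr
    _ = (1 + c) * (a * (1 - a) * ‖y - x‖ ^ 2
        + ((1 - a) * Metric.infDist x S ^ 2 + a * Metric.infDist y S ^ 2) / c) := by ring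
    _ ≤ _ := by
        have : a * (1 - a) ≤ 1 / 4 := by nlinarith [sq_nonneg (a - 1 / 2)]
        have h2 : a * (1 - a) * ‖y - x‖ ^ 2 ≤ ‖y - x‖ ^ 2 / 4 := by
          nlinarith [sq_nonneg ‖y - x‖]
        gcongr

theorem setLIntegral_grid_affine {T : ℕ} (hT : 0 < T) (i : ℕ) {A B D : ℝ} (hA : 0 ≤ A)
    (hB : 0 ≤ B) (hD : 0 ≤ D) :
    ∫⁻ t in Icc ((i : ℝ) / T) ((i + 1 : ℝ) / T),
      ENNReal.ofReal (A + ((1 - (T * t - i)) * B + (T * t - i) * D))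
      = ENNReal.ofReal ((A + (B + D) / 2) / T) := by
  have hT' : (0 : ℝ) < T := by exact_mod_cast hT
  have hle : (i : ℝ) / T ≤ (i + 1 : ℝ) / T := by gcongr; linarith
  have hcont : Continuous fun t : ℝ => A + ((1 - (T * t - i)) * B + (T * t - i) * D) := by fun_prop
  rw [← ofReal_integral_eq_lintegral_ofReal (hcont.integrableOn_Icc)]
  · congr 1
    rw [integral_Icc_eq_integral_Ioc, ← intervalIntegral.integral_of_le hle]
    have hderiv : ∀ t : ℝ, HasDerivAt
        (fun t : ℝ => A * t + (B * (t - (T * t - i) ^ 2 / (2 * T)) + D * ((T * t - i) ^ 2 / (2 * T))))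
        (A + ((1 - (T * t - i)) * B + (T * t - i) * D)) t := by
      intro t
      have h1 : HasDerivAt (fun t : ℝ => (T * t - i) ^ 2 / (2 * T)) (T * t - i) t := by
        have h0 : HasDerivAt (fun t : ℝ => (T * t - i : ℝ)) T t := by
          simpa using ((hasDerivAt_id t).const_mul (T : ℝ)).sub_const (i : ℝ)
        refine ((h0.pow 2).div_const (2 * (T : ℝ))).congr_deriv ?_
        field_simp
        simp
        ring
      refine (((hasDerivAt_id t).const_mul A).add ((((hasDerivAt_id t).sub h1).const_mul B).add
        (h1.const_mul D))).congr_deriv ?_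
      ring
    rw [intervalIntegral.integral_eq_sub_of_hasDerivAt (fun t _ => hderiv t)
      (hcont.intervalIntegrable _ _)]
    field_simp
    ring
  · refine (ae_restrict_iff' measurableSet_Icc).2 (Eventually.of_forall fun t ht => ?_)
    have h1 : (i : ℝ) ≤ T * t := by rw [mul_comm]; exact (div_le_iff₀ hT').1 ht.1
    have h2 : T * t ≤ (i : ℝ) + 1 := by rw [mul_comm]; exact (le_div_iff₀ hT').1 ht.2
    have h3 : 0 ≤ T * t - i := by linarith
    have h4 : 0 ≤ 1 - (T * t - i) := by linarith
    change 0 ≤ _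
    positivity

theorem exists_grid_cell {T : ℕ} (hT : 0 < T) (t : I) :
    ∃ i : Fin T, ∃ a : ℝ, 0 ≤ a ∧ a ≤ 1 ∧ (T : ℝ) * t = (i : ℕ) + a := by
  have hT' : (0 : ℝ) < T := by exact_mod_cast hT
  rcases eq_or_lt_of_le t.2.2 with h | h
  · refine ⟨⟨T - 1, by omega⟩, 1, zero_le_one, le_rfl, ?_⟩
    rw [h, Nat.cast_sub (by omega)]
    simp
  · have h0 : 0 ≤ (T : ℝ) * t := mul_nonneg hT'.le t.2.1
    have hlt : (T : ℝ) * t < T := mul_lt_of_lt_one_right hT' h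
    refine ⟨⟨⌊(T : ℝ) * t⌋₊, (Nat.floor_lt h0).2 hlt⟩, T * t - ⌊(T : ℝ) * t⌋₊, ?_, ?_, ?_⟩
    · linarith [Nat.floor_le h0]
    · linarith [Nat.lt_floor_add_one ((T : ℝ) * t)]
    · simp

theorem relaxed_construction {X : Set (Euc d)} {s₀ s₁ : MM X} (hs₀ : s₀ ∈ SS X)
    (hs₁ : s₁ ∈ SS X) {C : ℝ} {T N : ℕ} (hT : 0 < T) {P : Fin N → Set (Euc d)}
    (hP : IsEquipartition X C P) {lam : ℝ} (hlam : 0 < lam) {m : Fin (T + 1) → MN X P}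
    (hm : IsDiscreteMinimizer X s₀ s₁ lam m) :
    ∫⁻ t : I, W2sq ((plFlowMeasure m).map fun w => w t) (leb X)
      ≤ ENNReal.ofReal (1 / (4 * (T : ℝ) ^ 2) * discreteEnergy' X s₀ s₁ T P lam) := by
  have hT' : (0 : ℝ) < T := by exact_mod_cast hT
  set c : ℝ := 4 * T / lam with hc_def
  have hc : 0 < c := by positivity
  set q : Fin (T + 1) → ℝ := fun i => Metric.infDist (m i : MM X) (SS X) ^ 2 with hq
  set F : ℝ → ℝ≥0∞ := fun t =>
    W2sq ((plFlowMeasure m).map fun w => w (projIcc 0 1 zero_le_one t)) (leb X) with hF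
  set δ : Fin T → ℝ := fun i => ‖(m i.succ : MM X) - m i.castSucc‖ ^ 2 with hδ
  have hI : ∫⁻ t : I, W2sq ((plFlowMeasure m).map fun w => w t) (leb X)
      = ∫⁻ t in Icc (0 : ℝ) 1, F t := by
    rw [← lintegral_subtype_comap measurableSet_Icc]
    refine lintegral_congr fun t => ?_
    rw [hF]
    simp only [projIcc_val]
  have hcover : Icc (0 : ℝ) 1 ⊆ ⋃ i : Fin T, Icc (((i : ℕ) : ℝ) / T) ((((i : ℕ) : ℝ) + 1) / T) := by
    intro t ht
    obtain ⟨i, a, ha₀, ha₁, hta⟩ := exists_grid_cell hT ⟨t, ht⟩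
    change (T : ℝ) * t = _ at hta
    refine mem_iUnion.2 ⟨i, ?_, ?_⟩
    · rw [div_le_iff₀ hT']; linarith
    · rw [le_div_iff₀ hT']; linarith
  have hcell : ∀ i : Fin T, ∫⁻ t in Icc (((i : ℕ) : ℝ) / T) ((((i : ℕ) : ℝ) + 1) / T), F t
      ≤ ENNReal.ofReal (((1 + c) * δ i / 4
        + ((1 + c) / c * q i.castSucc + (1 + c) / c * q i.succ) / 2) / T) := by
    intro i
    rw [← setLIntegral_grid_affine hT i (by positivity) (by positivity) (by positivity)]
    refine setLIntegral_mono' measurableSet_Icc fun t ht => ?_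
    have h1 : ((i : ℕ) : ℝ) ≤ T * t := by rw [mul_comm]; exact (div_le_iff₀ hT').1 ht.1
    have h2 : T * t ≤ ((i : ℕ) : ℝ) + 1 := by rw [mul_comm]; exact (le_div_iff₀ hT').1 ht.2
    have hi : ((i : ℕ) : ℝ) + 1 ≤ T := by exact_mod_cast i.2
    have ht01 : t ∈ Icc (0 : ℝ) 1 := by
      refine ⟨(by positivity : (0 : ℝ) ≤ ((i : ℕ) : ℝ) / T).trans ht.1, ht.2.trans ?_⟩
      rwa [div_le_one hT']
    have ha : 0 ≤ T * t - ((i : ℕ) : ℝ) := by linarith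
    have ha' : T * t - ((i : ℕ) : ℝ) ≤ 1 := by linarith
    rw [hF]
    simp only [projIcc_of_mem zero_le_one ht01]
    rw [map_eval_plFlowMeasure hP m i (a := T * t - ((i : ℕ) : ℝ)) ha ha' (by simp)]
    refine (W2sq_map_le_infDist ⟨s₀, hs₀⟩ _).trans (ENNReal.ofReal_le_ofReal ?_)
    refine (infDist_sq_segment_le (SS X) hc ha ha' _ _).trans_eq ?_
    rw [hδ, hq]
    field_simp
  have hq_le : ∀ i, q i ≤ defect X s₀ s₁ (fun i => (m i : MM X)) i :=
    fun i => infDist_sq_le_defect hs₀ hs₁ (fun i => (m i : MM X)) i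
  have hq0 : ∀ i, 0 ≤ q i := fun i => sq_nonneg _
  have hsum1 : ∑ i : Fin T, q i.succ ≤ ∑ i, defect X s₀ s₁ (fun i => (m i : MM X)) i := by
    refine le_trans ?_ (Finset.sum_le_sum fun i _ => hq_le i)
    rw [Fin.sum_univ_succ q]
    linarith [hq0 0]
  have hsum2 : ∑ i : Fin T, q i.castSucc ≤ ∑ i, defect X s₀ s₁ (fun i => (m i : MM X)) i := by
    refine le_trans ?_ (Finset.sum_le_sum fun i _ => hq_le i)
    rw [Fin.sum_univ_castSucc q]
    linarith [hq0 (Fin.last T)]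
  calc ∫⁻ t : I, W2sq ((plFlowMeasure m).map fun w => w t) (leb X)
      ≤ ∑ i : Fin T, ∫⁻ t in Icc (((i : ℕ) : ℝ) / T) ((((i : ℕ) : ℝ) + 1) / T), F t := by
        rw [hI]
        refine (lintegral_mono_set hcover).trans ((lintegral_iUnion_le _ _).trans_eq ?_)
        rw [tsum_fintype]
    _ ≤ ∑ i : Fin T, ENNReal.ofReal (((1 + c) * δ i / 4
        + ((1 + c) / c * q i.castSucc + (1 + c) / c * q i.succ) / 2) / T) :=
        Finset.sum_le_sum fun i _ => hcell i
    _ = ENNReal.ofReal (∑ i : Fin T, ((1 + c) * δ i / 4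
        + ((1 + c) / c * q i.castSucc + (1 + c) / c * q i.succ) / 2) / T) :=
        (ENNReal.ofReal_sum_of_nonneg fun i _ => by positivity).symm
    _ ≤ _ := by
        refine ENNReal.ofReal_le_ofReal ?_
        rw [discreteEnergy', hm.discreteEnergy_eq, discreteFunctional_eq hT, ← hc_def]
        have e : ∑ i : Fin T, ((1 + c) * δ i / 4
            + ((1 + c) / c * q i.castSucc + (1 + c) / c * q i.succ) / 2) / T
            = (1 + c) * ((∑ i, δ i) / 4
              + (∑ i : Fin T, q i.castSucc + ∑ i : Fin T, q i.succ) / (2 * c)) / T := by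
          rw [← Finset.sum_add_distrib, Finset.sum_div, Finset.sum_div, ← Finset.sum_add_distrib,
            Finset.mul_sum, Finset.sum_div]
          refine Finset.sum_congr rfl fun i _ => ?_
          field_simp
        rw [e]
        calc (1 + c) * ((∑ i, δ i) / 4
              + (∑ i : Fin T, q i.castSucc + ∑ i : Fin T, q i.succ) / (2 * c)) / T
            ≤ (1 + c) * ((∑ i, δ i) / 4
              + (∑ i, defect X s₀ s₁ (fun i => (m i : MM X)) i
                + ∑ i, defect X s₀ s₁ (fun i => (m i : MM X)) i) / (2 * c)) / T := by
              gcongr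
          _ = _ := by
              rw [hc_def]
              field_simp
              ring

/-! ### Tightness -/

/-- Paths issued from the ball of radius `R` and which are `1/2`-Hölder with constant `R`. -/
def holderPaths (d : ℕ) (R : ℝ) : Set C(I, Euc d) :=
  {w | ‖w 0‖ ≤ R ∧ ∀ s t : I, ‖w t - w s‖ ^ 2 ≤ dist s t * R ^ 2}

theorem isCompact_holderPaths {R : ℝ} (hR : 0 ≤ R) : IsCompact (holderPaths d R) := by
  have hmod : ∀ w : I → Euc d, (∀ s t : I, ‖w t - w s‖ ^ 2 ≤ dist s t * R ^ 2) →
      ∀ s t : I, dist (w s) (w t) ≤ √(dist s t * R ^ 2) := fun w hw s t => by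
    rw [dist_comm, dist_eq_norm]
    exact Real.le_sqrt_of_sq_le (hw s t)
  have hlim : Tendsto (fun r : ℝ => √(r * R ^ 2)) (𝓝 0) (𝓝 0) := by
    have : Continuous fun r : ℝ => √(r * R ^ 2) := by fun_prop
    simpa using this.tendsto 0
  refine ArzelaAscoli.isCompact_of_equicontinuous _ ?_ ?_
  · have himage : ContinuousMap.toFun '' holderPaths d R
        = {w : I → Euc d | ‖w 0‖ ≤ R ∧ ∀ s t : I, ‖w t - w s‖ ^ 2 ≤ dist s t * R ^ 2} := by
      ext w
      constructor
      · rintro ⟨w, hw, rfl⟩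
        exact hw
      · intro hw
        have hc : Continuous w := by
          exact (Metric.equicontinuous_of_continuity_modulus _ hlim (fun _ : Unit => w)
            fun s t _ => hmod w hw.2 s t).continuous ()
        exact ⟨⟨w, hc⟩, hw, rfl⟩
    rw [himage]
    refine IsCompact.of_isClosed_subset
      (isCompact_univ_pi fun _ : I => isCompact_closedBall (0 : Euc d) (R + R)) ?_ ?_
    · simp only [ofPred_and, ofPred_forall]
      refine (isClosed_le (by fun_prop) continuous_const).inter
        (isClosed_iInter fun s => isClosed_iInter fun t =>
          isClosed_le (by fun_prop) continuous_const)
    · intro w hw t _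
      rw [mem_closedBall_zero_iff]
      have h1 : ‖w t - w 0‖ ≤ R := by
        refine le_of_sq_le_sq ((hw.2 0 t).trans ?_) hR
        refine mul_le_of_le_one_left (sq_nonneg _) ?_
        rw [Subtype.dist_eq, Real.dist_eq]
        change |(0 : ℝ) - t| ≤ 1
        rw [zero_sub, abs_neg, abs_of_nonneg t.2.1]
        exact t.2.2
      calc ‖w t‖ = ‖w 0 + (w t - w 0)‖ := by congr 1; abel
        _ ≤ R + R := (norm_add_le _ _).trans (add_le_add hw.1 h1)
  · exact Metric.equicontinuous_of_continuity_modulus _ hlim _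
      fun s t w => hmod w.1 w.2.2 s t

theorem plFlowMeasure_compl_holderPaths_le {X : Set (Euc d)} {C : ℝ} {T N : ℕ}
    {P : Fin N → Set (Euc d)} (hP : IsEquipartition X C P) (m : Fin (T + 1) → MN X P) {R : ℝ}
    (hR : 0 < R) :
    plFlowMeasure m (holderPaths d R)ᶜ ≤ ENNReal.ofReal
      (((T * ∑ i : Fin T, ‖(m i.succ : MM X) - m i.castSucc‖ ^ 2) + ‖(m 0 : MM X)‖ ^ 2)
        / R ^ 2) := by
  set M : Fin (T + 1) → MM X := fun i => (m i : MM X) with hM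
  have hR2 : 0 < R ^ 2 := by positivity
  have hmeas : MeasurableSet (holderPaths d R)ᶜ :=
    (isCompact_holderPaths hR.le).isClosed.measurableSet.compl
  rw [plFlowMeasure_eq_map hP, Measure.map_apply_of_aemeasurable (aemeasurable_plPath M) hmeas]
  have hA : AEMeasurable (fun x => ENNReal.ofReal (chainEnergy fun i => M i x)) (leb X) := by
    have : Measurable fun v : Fin (T + 1) → Euc d => ENNReal.ofReal (chainEnergy v) := by
      unfold chainEnergy
      fun_prop
    exact this.comp_aemeasurable (aemeasurable_chain M)
  have hB : AEMeasurable (fun x => ‖M 0 x‖ₑ ^ 2) (leb X) :=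
    (Lp.aestronglyMeasurable (M 0)).aemeasurable.enorm.pow_const 2
  -- outside two events controlled by Markov's inequality, the path lies in `holderPaths d R`
  have hsub : (fun x => plPath fun i => M i x) ⁻¹' (holderPaths d R)ᶜ
      ⊆ {x | ENNReal.ofReal (R ^ 2) ≤ ENNReal.ofReal (chainEnergy fun i => M i x)}
        ∪ {x | ENNReal.ofReal (R ^ 2) ≤ ‖M 0 x‖ₑ ^ 2} := by
    intro x hx
    by_contra hcon
    rw [mem_union, not_or] at hcon
    obtain ⟨h1, h2⟩ := hcon
    rw [mem_ofPred_eq, not_le] at h1 h2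
    have h1' : chainEnergy (fun i => M i x) < R ^ 2 := (ENNReal.ofReal_lt_ofReal_iff hR2).1 h1
    have h2' : ‖M 0 x‖ < R := by
      rw [← ofReal_norm, ← ENNReal.ofReal_pow (norm_nonneg _),
        ENNReal.ofReal_lt_ofReal_iff hR2] at h2
      exact lt_of_pow_lt_pow_left₀ 2 hR.le h2
    refine hx ⟨?_, fun s t => (norm_sq_plPath_sub_le_dist _ s t).trans ?_⟩
    · rw [plPath_eq_add_sum, Finset.sum_eq_zero, add_zero]
      · exact h2'.le
      · intro i _
        rw [ramp_of_nonpos (by simp), zero_smul]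
    · gcongr
  refine (measure_mono hsub).trans ((measure_union_le _ _).trans ?_)
  have hne : ENNReal.ofReal (R ^ 2) ≠ 0 := (ENNReal.ofReal_pos.2 hR2).ne'
  refine (add_le_add (meas_ge_le_lintegral_div hA hne ENNReal.ofReal_ne_top)
    (meas_ge_le_lintegral_div hB hne ENNReal.ofReal_ne_top)).trans_eq ?_
  rw [lintegral_chainEnergy, lintegral_enorm_sq_Lp, ← ENNReal.add_div,
    ← ENNReal.ofReal_add (by positivity) (by positivity), ← ENNReal.ofReal_div_of_pos hR2]

theorem isTightMeasureSet_range_of_bound {ι : Type*} (μ : ι → Measure C(I, Euc d)) {B : ℝ}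
    (hB : ∀ k, ∀ R > 0, μ k (holderPaths d R)ᶜ ≤ ENNReal.ofReal (B / R ^ 2)) :
    IsTightMeasureSet (range μ) := by
  rw [isTightMeasureSet_iff_exists_isCompact_measure_compl_le]
  intro ε hε
  have hlim : Tendsto (fun R : ℝ => ENNReal.ofReal (B / R ^ 2)) atTop (𝓝 0) := by
    have h : Tendsto (fun R : ℝ => B / R ^ 2) atTop (𝓝 0) :=
      (tendsto_pow_atTop two_ne_zero).const_div_atTop B
    simpa [Function.comp_def] using (ENNReal.continuous_ofReal.tendsto 0).comp h
  obtain ⟨R, hR, hR0⟩ := ((hlim.eventually_le_const hε).and (eventually_gt_atTop 0)).exists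
  refine ⟨holderPaths d R, isCompact_holderPaths hR0.le, ?_⟩
  rintro _ ⟨k, rfl⟩
  exact (hB k R hR0).trans hR

/-! ### Identification of limits -/

/-- Maps approaching the set of measure preserving maps in `L²` converge in law to the normalized
Lebesgue measure. -/
theorem map_eq_leb_of_tendsto {X : Set (Euc d)} [IsProbabilityMeasure (leb X)]
    (hne : (SS X).Nonempty) {f : ℕ → MM X}
    (hf : Tendsto (fun k => Metric.infDist (f k) (SS X)) atTop (𝓝 0))
    {ρ : ℕ → ProbabilityMeasure (Euc d)} (hρ : ∀ k, (ρ k : Measure (Euc d)) = (leb X).map (f k))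
    {ρ' : ProbabilityMeasure (Euc d)} (hlim : Tendsto ρ atTop (𝓝 ρ')) :
    (ρ' : Measure (Euc d)) = leb X := by
  have hs : ∀ k, ∃ s ∈ SS X, dist (f k) s < Metric.infDist (f k) (SS X) + 1 / ((k : ℝ) + 1) :=
    fun k => (Metric.infDist_lt_iff hne).1 (lt_add_of_pos_right _ (by positivity))
  choose s hsS hsd using hs
  have hfm : ∀ k, AEMeasurable (f k) (leb X) := fun k =>
    (Lp.aestronglyMeasurable (f k)).aemeasurable
  have hsm : ∀ k, AEMeasurable (s k) (leb X) := fun k =>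
    (Lp.aestronglyMeasurable (s k)).aemeasurable
  have hsub : Tendsto (fun k => f k - s k) atTop (𝓝 (0 : MM X)) := by
    rw [tendsto_zero_iff_norm_tendsto_zero]
    refine squeeze_zero (fun _ => norm_nonneg _) (fun k => ?_)
      (g := fun k : ℕ => Metric.infDist (f k) (SS X) + 1 / ((k : ℝ) + 1))
      (by simpa only [add_zero] using hf.add tendsto_one_div_add_atTop_nhds_zero_nat)
    rw [← dist_eq_norm]
    exact (hsd k).le
  have hmeas : TendstoInMeasure (leb X)
      ((fun k => (f k : Euc d → Euc d)) - fun k => (s k : Euc d → Euc d)) atTop 0 := by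
    refine (tendstoInMeasure_of_tendsto_Lp hsub).congr (fun k => Lp.coeFn_sub _ _) ?_
    exact Lp.coeFn_zero _ _ _
  -- the nearby measure preserving maps `s k` all have the law `leb X`
  have hsid : TendstoInDistribution (fun k => (s k : Euc d → Euc d)) atTop id
      (fun _ => leb X) (leb X) := by
    refine ⟨hsm, aemeasurable_id, tendsto_const_nhds.congr fun k => Subtype.ext ?_⟩
    change (leb X).map id = (leb X).map (s k)
    rw [Measure.map_id]
    exact (hsS k).symm
  have hfid := tendstoInDistribution_of_tendstoInMeasure_sub (fun k => (f k : Euc d → Euc d)) id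
    hsid hmeas hfm
  have huniq := tendsto_nhds_unique hlim
    (hfid.tendsto.congr fun k => Subtype.ext (hρ k).symm)
  rw [huniq]
  exact Measure.map_id

theorem map_pair_eq_of_tendsto {X : Set (Euc d)} [IsProbabilityMeasure (leb X)]
    {f g : ℕ → MM X} {s s' : MM X} (hf : Tendsto f atTop (𝓝 s)) (hg : Tendsto g atTop (𝓝 s'))
    {ρ : ℕ → ProbabilityMeasure (Euc d × Euc d)}
    (hρ : ∀ k, (ρ k : Measure (Euc d × Euc d)) = (leb X).map fun x => (f k x, g k x))
    {ρ' : ProbabilityMeasure (Euc d × Euc d)} (hlim : Tendsto ρ atTop (𝓝 ρ')) :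
    (ρ' : Measure (Euc d × Euc d)) = (leb X).map fun x => (s x, s' x) := by
  have hm : ∀ h : MM X, AEMeasurable h (leb X) := fun h =>
    (Lp.aestronglyMeasurable h).aemeasurable
  have hmeas : TendstoInMeasure (leb X) (fun k x => (f k x, g k x)) atTop
      (fun x => (s x, s' x)) := by
    intro ε hε
    have h1 := (tendstoInMeasure_of_tendsto_Lp hf) ε hε
    have h2 := (tendstoInMeasure_of_tendsto_Lp hg) ε hε
    refine tendsto_of_tendsto_of_tendsto_of_le_of_le tendsto_const_nhds
      (by simpa using h1.add h2) (fun _ => zero_le) fun k => ?_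
    refine (measure_mono fun x hx => ?_).trans (measure_union_le _ _)
    rw [mem_ofPred_eq, Prod.edist_eq, le_sup_iff] at hx
    exact hx
  have hdist := hmeas.tendstoInDistribution fun k => (hm (f k)).prodMk (hm (g k))
  have huniq := tendsto_nhds_unique hlim
    (hdist.tendsto.congr fun k => Subtype.ext (hρ k).symm)
  rw [huniq]
  rfl

/-- A generalized flow with incompressible marginals is carried by the paths in `X`. -/
theorem ae_mem_range_incl {X : Set (Euc d)} (hX : IsClosed X) {μ : Measure C(I, Euc d)}
    (hμ : ∀ t : I, μ.map (fun w => w t) = leb X) : ∀ᵐ w ∂μ, w ∈ range (incl X) := by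
  obtain ⟨D, hDc, hDd⟩ := TopologicalSpace.exists_countable_dense I
  have hae : ∀ᵐ x ∂(leb X), x ∈ X := by
    refine Measure.ae_smul_measure ?_ _
    exact ae_restrict_mem hX.measurableSet
  have h : ∀ᵐ w ∂μ, ∀ t ∈ D, w t ∈ X := by
    rw [ae_ball_iff hDc]
    intro t _
    rw [← hμ t] at hae
    exact ae_of_ae_map (continuous_eval t).measurable.aemeasurable hae
  filter_upwards [h] with w hw
  have hall : ∀ t : I, w t ∈ X := by
    intro t
    exact (hX.preimage w.continuous).closure_subset_iff.2 (fun r hr => hw r hr) (hDd t)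
  exact ⟨⟨fun t => ⟨w t, hall t⟩, by fun_prop⟩, rfl⟩

theorem isClosedEmbedding_incl {X : Set (Euc d)} (hX : IsClosed X) :
    IsClosedEmbedding (incl X) := by
  refine ⟨ContinuousMap.isEmbedding_postcomp ⟨Subtype.val, continuous_subtype_val⟩
    IsEmbedding.subtypeVal, ?_⟩
  have : range (incl X) = ⋂ t : I, {w : C(I, Euc d) | w t ∈ X} := by
    ext w
    rw [mem_iInter]
    constructor
    · rintro ⟨w, rfl⟩ t
      exact (w t).2
    · intro h
      exact ⟨⟨fun t => ⟨w t, h t⟩, by fun_prop⟩, rfl⟩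
  rw [this]
  exact isClosed_iInter fun t => hX.preimage (continuous_eval t)

/-- A probability measure carried by the paths in `X` comes from one on the space of such paths. -/
theorem exists_map_incl_eq {X : Set (Euc d)} (hX : IsClosed X)
    (μ : ProbabilityMeasure C(I, Euc d))
    (hμ : ∀ᵐ w ∂(μ : Measure C(I, Euc d)), w ∈ range (incl X)) :
    ∃ ν : ProbabilityMeasure C(I, X),
      ν.map (continuous_incl X).measurable.aemeasurable = μ := by
  have hemb : MeasurableEmbedding (incl X) := (isClosedEmbedding_incl hX).measurableEmbedding
  have hmap : ((μ : Measure C(I, Euc d)).comap (incl X)).map (incl X) = μ := by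
    rw [hemb.map_comap, Measure.restrict_eq_self_of_ae_mem hμ]
  have hprob : IsProbabilityMeasure ((μ : Measure C(I, Euc d)).comap (incl X)) := by
    refine ⟨?_⟩
    have h : ((μ : Measure C(I, Euc d)).comap (incl X)).map (incl X) univ = 1 := by
      rw [hmap]; exact measure_univ
    rwa [hemb.map_apply, preimage_univ] at h
  exact ⟨⟨_, hprob⟩, Subtype.ext hmap⟩

/-! ### Lower semicontinuity of the energy -/

theorem measurable_ofReal_gridEnergy (n : ℕ) :
    Measurable fun w : C(I, Euc d) => ENNReal.ofReal (gridEnergy n (lineExt w)) :=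
  ENNReal.measurable_ofReal.comp (continuous_gridEnergy_lineExt n).measurable

theorem lintegral_iSup_gridEnergy_le {μ : ProbabilityMeasure C(I, Euc d)}
    {μs : ℕ → ProbabilityMeasure C(I, Euc d)} (hlim : Tendsto μs atTop (𝓝 μ)) {b : ℕ → ℝ≥0∞}
    {L : ℝ≥0∞} (hb : Tendsto b atTop (𝓝 L))
    (hle : ∀ n k, ∫⁻ w, ENNReal.ofReal (gridEnergy n (lineExt w)) ∂(μs k : Measure C(I, Euc d))
      ≤ b k) :
    ∫⁻ w, ⨆ k : ℕ, ENNReal.ofReal (gridEnergy (2 ^ k) (lineExt w)) ∂(μ : Measure C(I, Euc d))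
      ≤ L := by
  rw [lintegral_iSup]
  · refine iSup_le fun k => ?_
    refine (lintegral_le_liminf_lintegral_of_forall_isOpen_measure_le_liminf_measure
      (μs := fun j => (μs j : Measure C(I, Euc d))) (continuous_gridEnergy_lineExt (2 ^ k))
      (fun w => gridEnergy_nonneg _ _)
      fun G hG => ProbabilityMeasure.le_liminf_measure_open_of_tendsto hlim hG).trans ?_
    rw [← hb.liminf_eq]
    exact liminf_le_liminf (Eventually.of_forall fun j => hle _ j)
  · exact fun k => measurable_ofReal_gridEnergy (2 ^ k)
  · exact fun k l hkl w => ENNReal.ofReal_le_ofReal (monotone_gridEnergy_two_pow (lineExt w) hkl)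

theorem lintegral_gridEnergy_plFlowMeasure_le {X : Set (Euc d)} {C : ℝ} {T N : ℕ}
    {P : Fin N → Set (Euc d)} (hP : IsEquipartition X C P) (m : Fin (T + 1) → MN X P) (n : ℕ) :
    ∫⁻ w, ENNReal.ofReal (gridEnergy n (lineExt w)) ∂(plFlowMeasure m)
      ≤ ENNReal.ofReal (T * ∑ i : Fin T, ‖(m i.succ : MM X) - m i.castSucc‖ ^ 2) := by
  rw [plFlowMeasure_eq_map hP, lintegral_map' (measurable_ofReal_gridEnergy n).aemeasurable
    (aemeasurable_plPath fun i => (m i : MM X)),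
    ← lintegral_chainEnergy fun i => (m i : MM X)]
  exact lintegral_mono fun x => ENNReal.ofReal_le_ofReal (gridEnergy_plPath_le _ n)

theorem flowEnergy_le_lintegral_iSup {X : Set (Euc d)} (ν : ProbabilityMeasure C(I, X)) :
    flowEnergy X ν ≤ ∫⁻ w, ⨆ k : ℕ, ENNReal.ofReal (gridEnergy (2 ^ k) (lineExt w))
      ∂((ν.map (continuous_incl X).measurable.aemeasurable : ProbabilityMeasure C(I, Euc d)) :
        Measure C(I, Euc d)) := by
  rw [ProbabilityMeasure.toMeasure_map, lintegral_map (Measurable.iSup fun k =>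
    measurable_ofReal_gridEnergy (2 ^ k))
    (continuous_incl X).measurable]
  exact lintegral_mono fun w => action_le_iSup_gridEnergy _

/-! ### Convergence to a relaxed minimizer -/

/-- Because of the factor `1 + 4 T / lam`, the quantity `𝓔'` controls both the energy of the chain and
its defects, with constants which do not depend on `lam`. -/
theorem IsDiscreteMinimizer.energy_add_defect_le {X : Set (Euc d)} {s₀ s₁ : MM X}
    (hs₀ : s₀ ∈ SS X) (hs₁ : s₁ ∈ SS X) {T N : ℕ} (hT : 0 < T) {P : Fin N → Set (Euc d)} {lam : ℝ}
    (hlam : 0 < lam) {m : Fin (T + 1) → MN X P} (hm : IsDiscreteMinimizer X s₀ s₁ lam m) :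
    T * ∑ i : Fin T, ‖(m i.succ : MM X) - m i.castSucc‖ ^ 2
      + 4 * T * ∑ i, defect X s₀ s₁ (fun i => (m i : MM X)) i
      ≤ discreteEnergy' X s₀ s₁ T P lam := by
  have hT' : (0 : ℝ) < T := by exact_mod_cast hT
  have hD : 0 ≤ ∑ i, defect X s₀ s₁ (fun i => (m i : MM X)) i :=
    Finset.sum_nonneg fun i _ => defect_nonneg hs₀ hs₁ _ i
  rw [discreteEnergy', hm.discreteEnergy_eq, discreteFunctional_eq hT]
  have hA : 0 ≤ T * ∑ i : Fin T, ‖(m i.succ : MM X) - m i.castSucc‖ ^ 2 := by positivity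
  set A := T * ∑ i : Fin T, ‖(m i.succ : MM X) - m i.castSucc‖ ^ 2
  set D := ∑ i, defect X s₀ s₁ (fun i => (m i : MM X)) i
  have h : (1 + 4 * T / lam) * (A + lam * D) = A + 4 * T * D + (lam * D + 4 * T / lam * A) := by
    field_simp
    ring
  rw [h]
  have : 0 ≤ lam * D + 4 * T / lam * A := by positivity
  linarith

section Bounds

variable {X : Set (Euc d)} {s₀ s₁ : MM X} {T N : ℕ} {P : Fin N → Set (Euc d)} {lam : ℝ}
  {m : Fin (T + 1) → MN X P}

theorem IsDiscreteMinimizer.energy_le (hm : IsDiscreteMinimizer X s₀ s₁ lam m) (hs₀ : s₀ ∈ SS X)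
    (hs₁ : s₁ ∈ SS X) (hT : 0 < T) (hlam : 0 < lam) :
    T * ∑ i : Fin T, ‖(m i.succ : MM X) - m i.castSucc‖ ^ 2
      ≤ discreteEnergy' X s₀ s₁ T P lam := by
  have hD : 0 ≤ ∑ i, defect X s₀ s₁ (fun i => (m i : MM X)) i :=
    Finset.sum_nonneg fun i _ => defect_nonneg hs₀ hs₁ _ i
  have : 0 ≤ 4 * T * ∑ i, defect X s₀ s₁ (fun i => (m i : MM X)) i := by positivity
  linarith [hm.energy_add_defect_le hs₀ hs₁ hT hlam]

theorem IsDiscreteMinimizer.defect_le (hm : IsDiscreteMinimizer X s₀ s₁ lam m) (hs₀ : s₀ ∈ SS X)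
    (hs₁ : s₁ ∈ SS X) (hT : 0 < T) (hlam : 0 < lam) (i : Fin (T + 1)) :
    defect X s₀ s₁ (fun i => (m i : MM X)) i ≤ discreteEnergy' X s₀ s₁ T P lam / (4 * T) := by
  have hT' : (0 : ℝ) < T := by exact_mod_cast hT
  have h1 := Finset.single_le_sum (fun i _ => defect_nonneg hs₀ hs₁ (fun i => (m i : MM X)) i)
    (Finset.mem_univ i)
  have hA : 0 ≤ T * ∑ i : Fin T, ‖(m i.succ : MM X) - m i.castSucc‖ ^ 2 := by positivity
  rw [le_div_iff₀ (by positivity)]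
  nlinarith [hm.energy_add_defect_le hs₀ hs₁ hT hlam]

theorem IsDiscreteMinimizer.discreteEnergy'_nonneg (hm : IsDiscreteMinimizer X s₀ s₁ lam m)
    (hs₀ : s₀ ∈ SS X) (hs₁ : s₁ ∈ SS X) (hT : 0 < T) (hlam : 0 < lam) :
    0 ≤ discreteEnergy' X s₀ s₁ T P lam :=
  le_trans (by positivity) (hm.energy_le hs₀ hs₁ hT hlam)

theorem IsDiscreteMinimizer.dist_zero_le (hm : IsDiscreteMinimizer X s₀ s₁ lam m)
    (hs₀ : s₀ ∈ SS X) (hs₁ : s₁ ∈ SS X) (hT : 0 < T) (hlam : 0 < lam) :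
    ‖(m 0 : MM X) - s₀‖ ≤ √(discreteEnergy' X s₀ s₁ T P lam / T) := by
  have hT' : (0 : ℝ) < T := by exact_mod_cast hT
  have h := hm.defect_le hs₀ hs₁ hT hlam 0
  rw [defect, if_pos rfl] at h
  refine Real.le_sqrt_of_sq_le (h.trans ?_)
  have := hm.discreteEnergy'_nonneg hs₀ hs₁ hT hlam
  gcongr
  linarith

theorem IsDiscreteMinimizer.dist_last_le (hm : IsDiscreteMinimizer X s₀ s₁ lam m)
    (hs₀ : s₀ ∈ SS X) (hs₁ : s₁ ∈ SS X) (hT : 0 < T) (hlam : 0 < lam) :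
    ‖(m (Fin.last T) : MM X) - s₁‖ ≤ √(discreteEnergy' X s₀ s₁ T P lam / T) := by
  have hT' : (0 : ℝ) < T := by exact_mod_cast hT
  have hne : Fin.last T ≠ 0 := by
    rw [Ne, Fin.ext_iff]; simp; omega
  have h := hm.defect_le hs₀ hs₁ hT hlam (Fin.last T)
  rw [defect, if_neg hne, if_pos rfl] at h
  refine Real.le_sqrt_of_sq_le (h.trans ?_)
  have := hm.discreteEnergy'_nonneg hs₀ hs₁ hT hlam
  gcongr
  linarith

/-- At every time, the interpolated chain is close to `𝕊`, by `infDist_sq_segment_le` with `c = 1`. -/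
theorem IsDiscreteMinimizer.infDist_segment_le (hm : IsDiscreteMinimizer X s₀ s₁ lam m)
    (hs₀ : s₀ ∈ SS X) (hs₁ : s₁ ∈ SS X) (hT : 0 < T) (hlam : 0 < lam) (i : Fin T) {a : ℝ}
    (ha₀ : 0 ≤ a) (ha₁ : a ≤ 1) :
    Metric.infDist ((1 - a) • (m i.castSucc : MM X) + a • (m i.succ : MM X)) (SS X)
      ≤ √(discreteEnergy' X s₀ s₁ T P lam / T) := by
  have hT' : (0 : ℝ) < T := by exact_mod_cast hT
  set E := discreteEnergy' X s₀ s₁ T P lam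
  have hδ : ‖(m i.succ : MM X) - m i.castSucc‖ ^ 2 ≤ E / T := by
    rw [le_div_iff₀ hT', mul_comm]
    refine le_trans ?_ (hm.energy_le hs₀ hs₁ hT hlam)
    gcongr
    exact Finset.single_le_sum (f := fun i : Fin T => ‖(m i.succ : MM X) - m i.castSucc‖ ^ 2)
      (fun i _ => sq_nonneg _) (Finset.mem_univ i)
  have hq : ∀ j, Metric.infDist (m j : MM X) (SS X) ^ 2 ≤ E / T / 4 := fun j => by
    rw [div_div, mul_comm (T : ℝ)]
    exact (infDist_sq_le_defect hs₀ hs₁ (fun i => (m i : MM X)) j).trans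
      (hm.defect_le hs₀ hs₁ hT hlam j)
  refine Real.le_sqrt_of_sq_le ((infDist_sq_segment_le (SS X) one_pos ha₀ ha₁ _ _).trans ?_)
  have h1 : (1 - a) * Metric.infDist (m i.castSucc : MM X) (SS X) ^ 2 ≤ (1 - a) * (E / T / 4) :=
    mul_le_mul_of_nonneg_left (hq _) (by linarith)
  have h2 : a * Metric.infDist (m i.succ : MM X) (SS X) ^ 2 ≤ a * (E / T / 4) :=
    mul_le_mul_of_nonneg_left (hq _) ha₀
  linarith

end Bounds

theorem map_endpoints_plFlowMeasure {X : Set (Euc d)} {C : ℝ} {T N : ℕ} (hT : 0 < T)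
    {P : Fin N → Set (Euc d)} (hP : IsEquipartition X C P) (m : Fin (T + 1) → MN X P) :
    (plFlowMeasure m).map (fun w => (w 0, w 1))
      = (leb X).map fun x => ((m 0 : MM X) x, (m (Fin.last T) : MM X) x) := by
  rw [plFlowMeasure_eq_map hP, AEMeasurable.map_map_of_aemeasurable
    (by fun_prop) (aemeasurable_plPath fun i => (m i : MM X))]
  congr 1
  ext1 x
  obtain ⟨T, rfl⟩ : ∃ k, T = k + 1 := ⟨T - 1, by omega⟩
  rw [Function.comp_apply, plPath_apply _ 0 0 le_rfl zero_le_one 0 (by simp),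
    plPath_apply _ (Fin.last T) 1 zero_le_one le_rfl 1 (by simp)]
  simp

/-- If `𝓔'(T, N_T, lam_T)` tends to the relaxed value along a sequence of parameters with
`T → ∞`, every weak limit of the associated flows is a relaxed minimizer. -/
theorem exists_relaxed_minimizer_of_tendsto {X : Set (Euc d)} (hX : IsCompact X)
    (hX₀ : volume X ≠ 0) {C : ℝ} {s₀ s₁ : MM X} (hs₀ : s₀ ∈ SS X) (hs₁ : s₁ ∈ SS X)
    {T N : ℕ → ℕ} [∀ k, NeZero (N k)] (hTpos : ∀ k, 0 < T k) (hTlim : Tendsto T atTop atTop)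
    {P : ∀ k, Fin (N k) → Set (Euc d)} (hP : ∀ k, IsEquipartition X C (P k)) {lam : ℕ → ℝ}
    (hlam : ∀ k, 0 < lam k) {m : ∀ k, Fin (T k + 1) → MN X (P k)}
    (hm : ∀ k, IsDiscreteMinimizer X s₀ s₁ (lam k) (m k)) (hfin : relaxedDistSq X s₀ s₁ ≠ ⊤)
    (hE : Tendsto (fun k => discreteEnergy' X s₀ s₁ (T k) (P k) (lam k)) atTop
      (𝓝 (relaxedDistSq X s₀ s₁).toReal))
    {μ : ProbabilityMeasure C(I, Euc d)}
    (hμ : Tendsto (fun k => plFlow (m k)) atTop (𝓝 μ)) :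
    ∃ ν : ProbabilityMeasure C(I, X), IsRelaxedMinimizer X s₀ s₁ ν ∧
      ν.map (continuous_incl X).measurable.aemeasurable = μ := by
  have := isProbabilityMeasure_leb hX hX₀
  have hrate : Tendsto (fun k => √(discreteEnergy' X s₀ s₁ (T k) (P k) (lam k) / T k)) atTop
      (𝓝 0) := by
    have h := hE.div_atTop (tendsto_natCast_atTop_atTop (R := ℝ).comp hTlim)
    simpa [Function.comp_def] using (Real.continuous_sqrt.tendsto 0).comp h
  have hinc : ∀ t : I, (μ : Measure C(I, Euc d)).map (fun w => w t) = leb X := by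
    intro t
    choose i a ha₀ ha₁ hta using fun k => exists_grid_cell (hTpos k) t
    have hdist : Tendsto (fun k => Metric.infDist ((1 - a k) • (m k (i k).castSucc : MM X)
        + a k • (m k (i k).succ : MM X)) (SS X)) atTop (𝓝 0) :=
      squeeze_zero (fun _ => Metric.infDist_nonneg) (fun k => (hm k).infDist_segment_le hs₀ hs₁
        (hTpos k) (hlam k) (i k) (ha₀ k) (ha₁ k)) hrate
    have hlim := ProbabilityMeasure.tendsto_map_of_tendsto_of_continuous _ _ hμ (continuous_eval t)
    refine map_eq_leb_of_tendsto ⟨s₀, hs₀⟩ hdist (fun k => ?_) hlim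
    exact map_eval_plFlowMeasure (hP k) (m k) (i k) (ha₀ k) (ha₁ k) (hta k)
  have hbdry : (μ : Measure C(I, Euc d)).map (fun w => (w 0, w 1))
      = (leb X).map fun x => (s₀ x, s₁ x) := by
    have h0 : Tendsto (fun k => (m k 0 : MM X)) atTop (𝓝 s₀) :=
      tendsto_iff_norm_sub_tendsto_zero.2 (squeeze_zero (fun _ => norm_nonneg _)
        (fun k => (hm k).dist_zero_le hs₀ hs₁ (hTpos k) (hlam k)) hrate)
    have h1 : Tendsto (fun k => (m k (Fin.last (T k)) : MM X)) atTop (𝓝 s₁) :=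
      tendsto_iff_norm_sub_tendsto_zero.2 (squeeze_zero (fun _ => norm_nonneg _)
        (fun k => (hm k).dist_last_le hs₀ hs₁ (hTpos k) (hlam k)) hrate)
    have hlim := ProbabilityMeasure.tendsto_map_of_tendsto_of_continuous _ _ hμ
      ((continuous_eval 0).prodMk (continuous_eval 1))
    refine map_pair_eq_of_tendsto h0 h1 (fun k => ?_) hlim
    exact map_endpoints_plFlowMeasure (hTpos k) (hP k) (m k)
  obtain ⟨ν, hν⟩ := exists_map_incl_eq hX.isClosed μ (ae_mem_range_incl hX.isClosed hinc)
  have hνμ : (ν : Measure C(I, X)).map (incl X) = μ := congrArg Subtype.val hν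
  have hincl : Measurable (incl X) := (continuous_incl X).measurable
  have hadm : IsAdmissibleFlow X s₀ s₁ ν := by
    refine ⟨?_, fun t => ?_⟩
    · rw [← hbdry, ← hνμ, Measure.map_map (by fun_prop) hincl]
      rfl
    · rw [← hinc t, ← hνμ, Measure.map_map (continuous_eval t).measurable hincl]
      rfl
  have henergy : flowEnergy X ν ≤ relaxedDistSq X s₀ s₁ := by
    refine (flowEnergy_le_lintegral_iSup ν).trans ?_
    rw [hν]
    have hb := (ENNReal.continuous_ofReal.tendsto _).comp hE
    rw [ENNReal.ofReal_toReal hfin] at hb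
    refine lintegral_iSup_gridEnergy_le hμ hb fun n k => ?_
    exact (lintegral_gridEnergy_plFlowMeasure_le (hP k) (m k) n).trans
      (ENNReal.ofReal_le_ofReal ((hm k).energy_le hs₀ hs₁ (hTpos k) (hlam k)))
  exact ⟨ν, ⟨hadm, fun ν' hν' => henergy.trans (iInf₂_le ν' hν')⟩, hν⟩

theorem exists_subseq_tendsto_plFlow {X : Set (Euc d)} {C : ℝ} {s₀ s₁ : MM X} (hs₀ : s₀ ∈ SS X)
    (hs₁ : s₁ ∈ SS X) {T N : ℕ → ℕ} [∀ k, NeZero (N k)] (hTpos : ∀ k, 0 < T k)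
    {P : ∀ k, Fin (N k) → Set (Euc d)} (hP : ∀ k, IsEquipartition X C (P k)) {lam : ℕ → ℝ}
    (hlam : ∀ k, 0 < lam k) {m : ∀ k, Fin (T k + 1) → MN X (P k)}
    (hm : ∀ k, IsDiscreteMinimizer X s₀ s₁ (lam k) (m k)) {B : ℝ}
    (hB : ∀ k, discreteEnergy' X s₀ s₁ (T k) (P k) (lam k) ≤ B) :
    ∃ (φ : ℕ → ℕ) (μ : ProbabilityMeasure C(I, Euc d)), StrictMono φ ∧
      Tendsto (fun k => plFlow (m (φ k))) atTop (𝓝 μ) := by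
  have htight : IsTightMeasureSet (range fun k => plFlowMeasure (m k)) := by
    refine isTightMeasureSet_range_of_bound _ (B := B + (√B + ‖s₀‖) ^ 2) fun k R hR => ?_
    refine (plFlowMeasure_compl_holderPaths_le (hP k) (m k) hR).trans
      (ENNReal.ofReal_le_ofReal ?_)
    have h1 := ((hm k).energy_le hs₀ hs₁ (hTpos k) (hlam k)).trans (hB k)
    have h2 : ‖(m k 0 : MM X)‖ ≤ √B + ‖s₀‖ := by
      have h3 := (hm k).dist_zero_le hs₀ hs₁ (hTpos k) (hlam k)
      have h4 : discreteEnergy' X s₀ s₁ (T k) (P k) (lam k) / T k ≤ B :=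
        (div_le_self ((hm k).discreteEnergy'_nonneg hs₀ hs₁ (hTpos k) (hlam k))
          (by exact_mod_cast hTpos k)).trans (hB k)
      have h5 := Real.sqrt_le_sqrt h4
      have h6 : ‖(m k 0 : MM X)‖ ≤ ‖(m k 0 : MM X) - s₀‖ + ‖s₀‖ := by
        simpa using norm_add_le ((m k 0 : MM X) - s₀) s₀
      linarith
    gcongr
  have hcomp : IsCompact (closure (range fun k => plFlow (m k))) := by
    refine isCompact_closure_of_isTightMeasureSet (htight.subset ?_)
    rintro _ ⟨_, ⟨k, rfl⟩, rfl⟩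
    exact ⟨k, rfl⟩
  obtain ⟨μ, -, φ, hφ, hlim⟩ := hcomp.tendsto_subseq fun k => subset_closure (mem_range_self k)
  exact ⟨φ, μ, hφ, hlim⟩

end GenFlow

open GenFlow
theorem mainTheorem2 {d : ℕ} (hd : 0 < d) (X : Set (Euc d)) (hX : IsCompact X)
    (hX₀ : volume X ≠ 0) (C : ℝ) (P : (N : ℕ) → Fin N → Set (Euc d))
    (hP : ∀ N : ℕ, 0 < N → IsEquipartition X C (P N))
    (s₀ s₁ : MM X) (hs₀ : s₀ ∈ SS X) (hs₁ : s₁ ∈ SS X) :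
    -- classical and relaxed construction, for fixed parameters
    (∀ (T N : ℕ) (lam : ℝ), 0 < T → 0 < N → 0 < lam →
      ∀ m : Fin (T + 1) → MN X (P N), IsDiscreteMinimizer X s₀ s₁ lam m →
        (∀ s : Fin (T + 1) → MM X, s 0 = s₀ → s (Fin.last T) = s₁ →
          (∀ i, 0 < i → i < Fin.last T → IsProjSS X (m i) (s i)) →
          T * ∑ i : Fin T, ‖s i.succ - s i.castSucc‖ ^ 2
            ≤ discreteEnergy' X s₀ s₁ T (P N) lam) ∧
        ∫⁻ t : I, W2sq ((plFlowMeasure m).map fun w => w t) (leb X)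
          ≤ ENNReal.ofReal (1 / (4 * (T : ℝ) ^ 2) * discreteEnergy' X s₀ s₁ T (P N) lam)) ∧
    -- convergence, along a subsequence, to a minimizer of the relaxed problem
    (∀ (N : ℕ → ℕ) [∀ T, NeZero (N T)] (lam : ℕ → ℝ), (∀ T, 0 < T → 0 < lam T) →
      ∀ m : (T : ℕ) → Fin (T + 1) → MN X (P (N T)),
        (∀ T, 0 < T → IsDiscreteMinimizer X s₀ s₁ (lam T) (m T)) →
        relaxedDistSq X s₀ s₁ ≠ ⊤ →
        Tendsto (fun T => discreteEnergy' X s₀ s₁ T (P (N T)) (lam T)) atTop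
          (𝓝 (relaxedDistSq X s₀ s₁).toReal) →
        ∃ (φ : ℕ → ℕ) (μ : ProbabilityMeasure C(I, X)), StrictMono φ ∧
          IsRelaxedMinimizer X s₀ s₁ μ ∧
          Tendsto (fun k => plFlow (m (φ k))) atTop
            (𝓝 (μ.map (continuous_incl X).measurable.aemeasurable))) := by
  refine ⟨fun T N lam hT hN hlam m hm => ⟨fun s h0 h1 hs => ?_, ?_⟩, ?_⟩
  · exact classical_construction hs₀ hT hlam hm h0 h1 hs
  · exact relaxed_construction hs₀ hs₁ hT (hP N hN) hlam hm
  · intro N _ lam hlam m hm hfin hE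
    -- discard `T = 0`, for which the chain is not assumed to be a minimizer
    have hE' := hE.comp (tendsto_add_atTop_nat 1)
    obtain ⟨B, hB⟩ := hE'.bddAbove_range
    obtain ⟨φ, μ, hφ, hμ⟩ := exists_subseq_tendsto_plFlow hs₀ hs₁ (T := fun k => k + 1)
      (N := fun k => N (k + 1)) (fun k => k.succ_pos)
      (fun k => hP (N (k + 1)) (NeZero.pos _)) (fun k => hlam (k + 1) k.succ_pos)
      (fun k => hm (k + 1) k.succ_pos) fun k => hB ⟨k, rfl⟩
    obtain ⟨ν, hν, hνμ⟩ := exists_relaxed_minimizer_of_tendsto hX hX₀ hs₀ hs₁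
      (T := fun k => φ k + 1) (N := fun k => N (φ k + 1)) (fun k => (φ k).succ_pos)
      (tendsto_atTop_mono (fun k => (hφ.id_le k).trans (Nat.le_succ _)) tendsto_id)
      (fun k => hP (N (φ k + 1)) (NeZero.pos _)) (fun k => hlam (φ k + 1) (φ k).succ_pos)
      (fun k => hm (φ k + 1) (φ k).succ_pos) hfin (hE'.comp hφ.tendsto_atTop) hμ
    refine ⟨fun k => φ k + 1, ν, fun a b hab => Nat.succ_lt_succ (hφ hab), hν, ?_⟩
    rw [hνμ]
    exact hμ
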